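/- **Setting.** Consider parameterized linear dynamic networks $$w(t)=G(q,\theta)w(t)+Rr(t)+\begin{bmatrix}\tilde H(q,\theta)\\0\end{bmatrix}\tilde e(t),\qquad w_{\mathcal C}(t)=Cw(t),\qquad \theta\in\Theta\subseteq\mathbb R^n,$$ with internal signals $\mathcal W=\{w_1,\dots,w_L\}$, of which those in $\mathcal C\subseteq\mathcal W$ are measured (the first block row is indexed by $\mathcal C$); excitation signals $r$, where $R$ consists of distinct columns of the identity matrix; and a white noise $\tilde e$, with one component per measured signal and covariance matrix $\tilde\Lambda(\theta)\succeq 0$. The entries of $G$ and $\tilde H$ are rational functions of $q$ and $\theta$. For every $\theta\in\Theta$: $G$ is proper, stable and has zero diagonal; $T=(I-G)^{-1}$ is stable; all principal minors of $\lim_{z\to\infty}(I-G(z))$ are nonzero; $\tilde H$ is proper, stable, monic ($\tilde H(\infty)=I$) and minimum phase (it is invertible and its inverse has no poles in $|z|>1$). Put $$X=\Big[R\ \ \begin{bmatrix}\tilde H\\0\end{bmatrix}\Big],\qquad \Phi(\omega,\theta)=T\begin{bmatrix}\tilde H\\0\end{bmatrix}\tilde\Lambda\begin{bmatrix}\tilde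 H\\0\end{bmatrix}^{\star}T^\star\Big|_{q=e^{i\omega}}.$$ Assume further: * (full rank) for every $\theta\in\Theta$, $C\Phi(\omega,\theta)C^\top$ has full rank for almost all $\omega$; * (minimum-phase response) for every $\theta\in\Theta$, the transfer matrix $CT\begin{bmatrix}\tilde H\\0\end{bmatrix}$ from $\tilde e$ to $w_{\mathcal C}$ is minimum phase; * (independent parameterization) no parameter is shared by two entries of $G$ and $\tilde H$; * (feedthrough) either $G(q,\theta)$ is strictly proper for all $\theta\in\Theta$, or $\tilde\Lambda(\theta)$ is diagonal for all $\theta\in\Theta$ and there is a permutation matrix $P$ such that $P\,G(\infty,\theta)P^\top$ is lower triangular for all $\theta\in\Theta$; * (fixed entries) every submatrix of $[\,G-I\ \ X\,]$ that does not depend on $\theta$ has rank equal to its structural rank, i.e. to the maximal rank of all matrices with the same pattern of nonzero entries. **Graph.** The vertices are the internal signals and the external signals $\mathcal X$ (the components of $r$ and $\tilde e$). There is an edge from $w_k$ to $w_l$ iff $G_{lk}$ is not fixed to zero, and from $x\in\mathcal X$ to $w_l$ iff the entry of $X$ in row $w_l$ and column $x$ is not fixed to zero. An edge is *known* if its entry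 does not depend on $\theta$, and *unknown* otherwise. A path does not repeat vertices, and a single vertex is a path; $b_{\mathcal A\to\mathcal B}$ is the maximum number of vertex disjoint paths from $\mathcal A$ to $\mathcal B$; an $\mathcal A-\mathcal B$ disconnecting set is a set of vertices that intersects all paths from $\mathcal A$ to $\mathcal B$ (it may contain vertices of $\mathcal A\cup\mathcal B$). Let $\mathcal X_j$ be the set of external signals that have no unknown edge to $w_j$; $\mathcal N_i^*$ the set of all in-neighbors of $w_i$ in $\mathcal W$; and $\mathcal N_j^-$ the set of in-neighbors of $w_j$ in $\mathcal W$ excluding the measured signals that have a known edge to $w_j$. **Identifiability.** $G_{ji}$ is *generically identifiable from $(w_{\mathcal C},r)$* if for all $\theta_0\in\Theta$ outside a set of Lebesgue measure zero the following holds for all $\theta_1\in\Theta$: if $CT(q,\theta_0)R=CT(q,\theta_1)R$ and $C\Phi(\omega,\theta_0)C^\top=C\Phi(\omega,\theta_1)C^\top$ for all $\omega$, then $G_{ji}(q,\theta_0)=G_{ji}(q,\theta_1)$. **Theorem.** Let $w_j\in\mathcal C$ be measured and $w_i\notin\mathcal C$ be unmeasured, and let $x_i\in\mathcal X$ be an external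 signal of out-degree one with a known edge to $w_i$. Suppose that for some $\bar{\mathcal X}\subseteq\mathcal X_j\setminus\{x_i\}$ and $\bar{\mathcal C}\subseteq\mathcal C$ there is a $\bar{\mathcal X}\cup\{x_i\}\,-\,\mathcal N_i^*\cup(\mathcal N_j^-\setminus\{w_i\})\cup\bar{\mathcal C}$ disconnecting set $\mathcal D$ such that 1. $b_{\bar{\mathcal X}\cup\{x_i\}\to\mathcal D\cup\{w_i\}}=1+|\mathcal D|$; 2. $b_{\mathcal D\to\bar{\mathcal C}}=|\mathcal D|$. Then $G_{ji}$ is generically identifiable from $(w_{\mathcal C},r)$. -/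

import Mathlib

open MeasureTheory Polynomial

noncomputable section

namespace DynNet

/-! ### Rational transfer functions -/

/-- Real rational transfer functions, as rational functions of the shift variable `z`
(so that the delay operator is `1 / z`). -/
abbrev TF : Type := RatFunc ℝ

namespace TF

/-- The limit for `z → ∞` exists. -/
def IsProper (f : TF) : Prop := f.num.degree ≤ f.denom.degree

/-- The limit for `z → ∞` is zero. -/
def IsStrictlyProper (f : TF) : Prop := f.num.degree < f.denom.degree

/-- All poles lie in the open unit disc. -/
def IsStable (f : TF) : Prop := ∀ z : ℂ, aeval z f.denom = 0 → ‖z‖ < 1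

/-- The limit for `z → ∞` of a proper transfer function (the denominator `f.denom` is monic). -/
def atInfinity (f : TF) : ℝ := f.num.coeff f.denom.natDegree

/-- The value on the unit circle at frequency `ω`. -/
def freq (f : TF) (ω : ℝ) : ℂ :=
  RatFunc.eval (algebraMap ℝ ℂ) (Complex.exp (Complex.I * (ω : ℂ))) f

end TF

/-- A square transfer matrix is minimum phase if it is invertible and its inverse has no pole
outside the closed unit disc. -/
def IsMinimumPhase {m : Type*} [Fintype m] [DecidableEq m] (A : Matrix m m TF) : Prop :=
  IsUnit A.det ∧ ∀ a b, ∀ z : ℂ, aeval z (A⁻¹ a b).denom = 0 → ‖z‖ ≤ 1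

/-- The largest rank of a matrix with the same pattern of nonzero entries. -/
def structuralRank {F m k : Type*} [Field F] [Fintype m] [Fintype k]
    (A : Matrix m k F) : ℕ :=
  sSup {r : ℕ | ∃ B : Matrix m k F, (∀ a b, B a b = 0 ↔ A a b = 0) ∧ B.rank = r}

/-! ### Paths in a directed graph -/

section Paths

variable {V : Type*} (E : V → V → Prop)

/-- A directed path (no repeated vertex) that starts in `A` and ends in `B`, given by its list of
vertices. A single vertex of `A ∩ B` is a path. -/
def IsPath (A B : Set V) (p : List V) : Prop :=
  p.Nodup ∧ p.IsChain E ∧ (∃ a ∈ A, p.head? = some a) ∧ (∃ b ∈ B, p.getLast? = some b)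

/-- The maximum number of vertex disjoint paths from `A` to `B`. -/
def maxDisjointPaths (A B : Set V) : ℕ :=
  sSup {k : ℕ | ∃ p : Fin k → List V,
    (∀ a, IsPath E A B (p a)) ∧ ∀ a b, a ≠ b → (p a).Disjoint (p b)}

/-- `D` meets every path from `A` to `B`. -/
def IsDisconnecting (A B D : Set V) : Prop :=
  ∀ p : List V, IsPath E A B p → ∃ v ∈ p, v ∈ D

end Paths

/-! ### Parameterized network model sets -/

/-- A rational parameterization of a transfer function: numerator and denominator are polynomials
in `z` whose coefficients are polynomials in the parameters `θ 0, …, θ (n - 1)`. -/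
structure RatParam (n : ℕ) where
  num : Polynomial (MvPolynomial (Fin n) ℝ)
  den : Polynomial (MvPolynomial (Fin n) ℝ)

namespace RatParam

variable {n : ℕ}

/-- The transfer function at the parameter vector `θ`. -/
def eval (p : RatParam n) (θ : Fin n → ℝ) : TF :=
  algebraMap ℝ[X] TF (p.num.map (MvPolynomial.eval θ)) /
    algebraMap ℝ[X] TF (p.den.map (MvPolynomial.eval θ))

/-- The parameters that occur in the parameterization. -/
def params (p : RatParam n) : Set (Fin n) :=
  {k | ∃ m, k ∈ (p.num.coeff m).vars ∨ k ∈ (p.den.coeff m).vars}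

end RatParam

/-- The data of a parameterized set of models
`w = G w + R r + [H; 0] e`, `cov e = Λ`, `w_C = C w`, with internal signals `w_0, …, w_(L-1)`,
excitation signals `r_0, …, r_(K-1)` entering at distinct internal signals, and one white noise
signal for every measured internal signal; the noise enters at the measured signals only. -/
structure ModelSet (L K n : ℕ) where
  /-- the parameter set -/
  Θ : Set (Fin n → ℝ)
  /-- the measured internal signals -/
  C : Finset (Fin L)
  /-- the internal signal at which each excitation signal enters -/
  rIn : Fin K ↪ Fin L
  /-- the modules: `Gpar j i` is the module from `w_i` to `w_j` -/
  Gpar : Fin L → Fin L → RatParam n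
  /-- the noise model of the measured signals -/
  Hpar : C → C → RatParam n
  /-- the noise covariance -/
  Λ : (Fin n → ℝ) → Matrix C C ℝ

namespace ModelSet

variable {L K n : ℕ} (M : ModelSet L K n)

/-- The external signals: excitation signals and noise signals. -/
abbrev Ext : Type := Fin K ⊕ M.C

/-- The vertices of the graph: internal signals and external signals. -/
abbrev Vert : Type := Fin L ⊕ M.Ext

def G (θ : Fin n → ℝ) : Matrix (Fin L) (Fin L) TF := fun j i => (M.Gpar j i).eval θ

/-- The noise model of the measured signals. -/
def Hmeas (θ : Fin n → ℝ) : Matrix M.C M.C TF := fun a b => (M.Hpar a b).eval θ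

/-- The noise model of all internal signals, with zero rows for the unmeasured ones. -/
def H (θ : Fin n → ℝ) : Matrix (Fin L) M.C TF := fun j k =>
  if hj : j ∈ M.C then M.Hmeas θ ⟨j, hj⟩ k else 0

def R : Matrix (Fin L) (Fin K) TF := fun j k => if j = M.rIn k then 1 else 0

/-- `X = [R  [H; 0]]`. -/
def X (θ : Fin n → ℝ) : Matrix (Fin L) M.Ext TF := Matrix.fromCols M.R (M.H θ)

/-- `T = (I - G)⁻¹`. -/
def T (θ : Fin n → ℝ) : Matrix (Fin L) (Fin L) TF := (1 - M.G θ)⁻¹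

/-- The limit of `G` for `z → ∞`. -/
def Ginf (θ : Fin n → ℝ) : Matrix (Fin L) (Fin L) ℝ := (M.G θ).map TF.atInfinity

/-- The rows of a matrix that correspond to the measured signals, `C * A`. -/
def measRows {k F : Type*} (A : Matrix (Fin L) k F) : Matrix M.C k F :=
  A.submatrix (fun a : M.C => (a : Fin L)) id

/-- The mapping `C T R` from the excitation signals to the measured signals. -/
def CTR (θ : Fin n → ℝ) : Matrix M.C (Fin K) TF := M.measRows (M.T θ * M.R)

/-- The mapping `C T [H; 0]` from the noise signals to the measured signals. -/
def CTH (θ : Fin n → ℝ) : Matrix M.C M.C TF := M.measRows (M.T θ * M.H θ)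

/-- The power spectrum `Φ = T H Λ Hᴴ Tᴴ` of the internal signals at frequency `ω`. -/
def Φ (θ : Fin n → ℝ) (ω : ℝ) : Matrix (Fin L) (Fin L) ℂ :=
  let Tω : Matrix (Fin L) (Fin L) ℂ := (M.T θ).map (fun f => TF.freq f ω)
  let Hω : Matrix (Fin L) M.C ℂ := (M.H θ).map (fun f => TF.freq f ω)
  let Λc : Matrix M.C M.C ℂ := (M.Λ θ).map (fun x : ℝ => (x : ℂ))
  Tω * Hω * Λc * Hω.conjTranspose * Tω.conjTranspose

/-- The power spectrum `C Φ Cᵀ` of the measured signals. -/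
def CΦC (θ : Fin n → ℝ) (ω : ℝ) : Matrix M.C M.C ℂ :=
  (M.Φ θ ω).submatrix (fun a : M.C => (a : Fin L)) (fun a : M.C => (a : Fin L))

/-! #### Standing assumptions -/

/-- Every `θ ∈ Θ` gives a well defined, stable and well-posed network model whose noise model is
proper, stable, monic and minimum phase. -/
structure IsAdmissible : Prop where
  den_ne_G : ∀ θ ∈ M.Θ, ∀ j i, (M.Gpar j i).den.map (MvPolynomial.eval θ) ≠ 0
  den_ne_H : ∀ θ ∈ M.Θ, ∀ a b, (M.Hpar a b).den.map (MvPolynomial.eval θ) ≠ 0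
  proper_G : ∀ θ ∈ M.Θ, ∀ j i, TF.IsProper (M.G θ j i)
  stable_G : ∀ θ ∈ M.Θ, ∀ j i, TF.IsStable (M.G θ j i)
  hollow_G : ∀ θ ∈ M.Θ, ∀ j, M.G θ j j = 0
  stable_T : ∀ θ ∈ M.Θ, ∀ j i, TF.IsStable (M.T θ j i)
  wellPosed : ∀ θ ∈ M.Θ, ∀ s : Finset (Fin L),
    ((1 - M.Ginf θ).submatrix (fun a : s => (a : Fin L)) (fun a : s => (a : Fin L))).det ≠ 0
  proper_H : ∀ θ ∈ M.Θ, ∀ a b, TF.IsProper (M.Hmeas θ a b)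
  stable_H : ∀ θ ∈ M.Θ, ∀ a b, TF.IsStable (M.Hmeas θ a b)
  monic_H : ∀ θ ∈ M.Θ, (M.Hmeas θ).map TF.atInfinity = 1
  minPhase_H : ∀ θ ∈ M.Θ, IsMinimumPhase (M.Hmeas θ)
  posSemidef_Λ : ∀ θ ∈ M.Θ, (M.Λ θ).PosSemidef

/-- The power spectrum of the measured signals has full rank at almost every frequency. -/
def FullRankSpectrum : Prop :=
  ∀ θ ∈ M.Θ, ∀ᵐ ω : ℝ, (M.CΦC θ ω).rank = M.C.card

/-- The parameterizations of all the transfer functions in `G` and `H`. -/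
def entryPar : (Fin L × Fin L) ⊕ (M.C × M.C) → RatParam n
  | Sum.inl e => M.Gpar e.1 e.2
  | Sum.inr e => M.Hpar e.1 e.2

/-- The transfer functions in `G` and `H` are parameterized independently: no parameter is shared
by two of them. -/
def IndependentlyParameterized : Prop :=
  ∀ e f, e ≠ f → Disjoint (M.entryPar e).params (M.entryPar f).params

/-- Either `G` is parameterized to be strictly proper, or `Λ` is diagonal and `G` is parameterized
without algebraic loops (its limit is lower triangular in a suitable order of the signals). -/
def FeedthroughCondition : Prop :=
  (∀ θ ∈ M.Θ, ∀ j i, TF.IsStrictlyProper (M.G θ j i)) ∨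
    ((∀ θ ∈ M.Θ, (M.Λ θ).IsDiag) ∧
      ∃ σ : Equiv.Perm (Fin L), ∀ θ ∈ M.Θ, ∀ j i, σ j < σ i → M.Ginf θ j i = 0)

/-- The transfer matrix `C T [H; 0]` from the noise signals to the measured signals is minimum
phase. -/
def MinimumPhaseResponse : Prop := ∀ θ ∈ M.Θ, IsMinimumPhase (M.CTH θ)

/-- The matrix `[G - I  X]`. -/
def GIX (θ : Fin n → ℝ) : Matrix (Fin L) M.Vert TF := Matrix.fromCols (M.G θ - 1) (M.X θ)

/-- Every submatrix of `[G - I  X]` that does not depend on `θ` has rank equal to its structural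
rank. -/
def FixedEntriesRegular : Prop :=
  ∀ (s : Finset (Fin L)) (t : Finset M.Vert),
    (∀ θ ∈ M.Θ, ∀ θ' ∈ M.Θ, ∀ a ∈ s, ∀ b ∈ t, M.GIX θ a b = M.GIX θ' a b) →
    ∀ θ ∈ M.Θ,
      ((M.GIX θ).submatrix (fun a : s => (a : Fin L)) (fun b : t => (b : M.Vert))).rank =
        structuralRank
          ((M.GIX θ).submatrix (fun a : s => (a : Fin L)) (fun b : t => (b : M.Vert)))

/-! #### The graph -/

/-- The entry of `[G  X]` that belongs to the edge from `v` to the internal signal `w_j`. -/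
def edgeTF (θ : Fin n → ℝ) (v : M.Vert) (j : Fin L) : TF :=
  match v with
  | Sum.inl i => M.G θ j i
  | Sum.inr x => M.X θ j x

/-- There is an edge from `v` to `w_j` if the corresponding entry is not fixed to zero; external
signals have no in-coming edges. -/
def Edge (v : M.Vert) : M.Vert → Prop
  | Sum.inl j => ∃ θ ∈ M.Θ, M.edgeTF θ v j ≠ 0
  | Sum.inr _ => False

/-- The entry from `v` to `w_j` is known (fixed): it does not depend on the parameters. -/
def Known (v : M.Vert) (j : Fin L) : Prop :=
  ∀ θ ∈ M.Θ, ∀ θ' ∈ M.Θ, M.edgeTF θ v j = M.edgeTF θ' v j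

/-- The out-degree of a vertex. -/
def outDegree (v : M.Vert) : ℕ := {u | M.Edge v u}.ncard

/-- `X_j`: the external signals without unknown edge to `w_j`. -/
def extNoUnknown (j : Fin L) : Set M.Vert :=
  {v | ∃ x : M.Ext, v = Sum.inr x ∧ ¬ (M.Edge v (Sum.inl j) ∧ ¬ M.Known v j)}

/-- `N_i^*`: all the in-neighbors of `w_i` among the internal signals. -/
def inNbrs (i : Fin L) : Set M.Vert :=
  {v | ∃ k : Fin L, v = Sum.inl k ∧ M.Edge v (Sum.inl i)}

/-- `N_j^-`: the in-neighbors of `w_j` among the internal signals, excluding the measured ones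
that have a known edge to `w_j`. -/
def inNbrsMinus (j : Fin L) : Set M.Vert :=
  {v | ∃ k : Fin L, v = Sum.inl k ∧ M.Edge v (Sum.inl j) ∧ ¬ (k ∈ M.C ∧ M.Known v j)}

/-- The measured internal signals as vertices. -/
def measVerts : Set M.Vert := {v | ∃ k ∈ M.C, v = Sum.inl k}

/-! #### Identifiability -/

/-- `G_ji` is generically identifiable from `(w_C, r)`: for all `θ₀ ∈ Θ` outside a set of Lebesgue
measure zero, the mapping `C T R` and the spectrum `C Φ Cᵀ` at `θ₀` determine `G_ji`. -/
def GenericallyIdentifiable (j i : Fin L) : Prop :=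
  ∀ᵐ θ₀ : Fin n → ℝ, θ₀ ∈ M.Θ → ∀ θ₁ ∈ M.Θ,
    M.CTR θ₀ = M.CTR θ₁ → (∀ ω : ℝ, M.CΦC θ₀ ω = M.CΦC θ₁ ω) →
      M.G θ₀ j i = M.G θ₁ j i

end ModelSet

end DynNet

end

open MeasureTheory Polynomial

noncomputable section

namespace DynNet

open scoped Matrix

/-! Fix θ₀ and θ₁ with the same data. Write A for X̄ ∪ {x_i}, t(v) for the row of responses of a
vertex v to the signals in A, and S for the span of the rows t(v) with v in D; indices 0 and 1 refer
to the two models. The measured spectrum determines CT[H; 0] (`CTH_eq_of_CΦC_eq`), so measured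
signals have the same responses in both models.

Since D disconnects A from N_i^*, N_j^- without w_i, and C̄, the responses of these signals lie in
S. This needs only the nonzero principal minors of I - G(∞) (`eq_zero_of_not_reachable`), so it
holds for every θ₁. For generic θ₀, condition 2 puts S₀ inside the span of the responses of C̄,
which is common to both models and lies in S₁. Condition 1 makes the responses of D and w_i
independent at θ₀, so dim S₀ = |D| ≥ dim S₁, hence S₀ = S₁, and t₀(w_i) is not in it. As w_i is
unmeasured, x_i is the only external signal that enters it, with gain one; so its equation reads
t(w_i) ≡ e modulo S in both models, with e the unit vector of x_i, and e is not in S. Subtracting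
the equations of w_j in the two models leaves (G_ji(θ₀) - G_ji(θ₁)) e in S, which forces equality.

Both path conditions reduce to nonsingularity of a square submatrix of [G - I X] with a transversal
of entries not fixed to zero: edges on the paths, and diagonal entries -1 off the paths
(`ae_eq_zero_of_eq_zero_on_target`, `ae_linearIndependent_resp`). Such a submatrix is generically
nonsingular (`ae_det_submatrix_ne_zero`). Otherwise it is singular for all parameters; as its
entries vary independently, a product of sets of matrices is singular, and
`exists_const_block_of_forall_det_eq_zero` yields a fixed block whose rank is too small for the
fixed-entries assumption.

For the spectrum, the quotient of two minimum phase factors has no poles outside the closed disc,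
and reflection in the unit circle excludes the others, so it is constant (`spectralFactor_unique`).
The feedthrough condition makes the constant the identity. -/

/-- The zero set of a nonzero real polynomial in several variables is a null set. -/
theorem ae_mvPolynomial_eval_ne_zero : ∀ {n : ℕ} (p : MvPolynomial (Fin n) ℝ), p ≠ 0 →
    ∀ᵐ θ : Fin n → ℝ, MvPolynomial.eval θ p ≠ 0
  | 0, p, hp => by
    refine Filter.Eventually.of_forall fun θ h => hp ?_
    rw [MvPolynomial.eq_C_of_isEmpty p] at h ⊢
    simp only [MvPolynomial.eval_C] at h
    rw [h, MvPolynomial.C_0]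
  | n + 1, p, hp => by
    have hmeas : Measurable fun θ : Fin (n + 1) → ℝ => MvPolynomial.eval θ p :=
      (MvPolynomial.continuous_eval p).measurable
    have hpres := volume_preserving_piFinSuccAbove (fun _ : Fin (n + 1) => ℝ) 0
    have hset : MeasurableSet {θ : Fin (n + 1) → ℝ | MvPolynomial.eval θ p = 0} :=
      hmeas (measurableSet_singleton 0)
    suffices h : volume {θ : Fin (n + 1) → ℝ | MvPolynomial.eval θ p = 0} = 0 by
      rw [ae_iff]
      simpa using h
    rw [← hpres.symm.measure_preimage hset.nullMeasurableSet, Measure.volume_eq_prod,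
      Measure.measure_prod_null ((MeasurableEquiv.measurable _) hset)]
    -- Fubini in the first coordinate: only finitely many of its values are roots of `P`, and for
    -- every other value the slice is the zero set of a nonzero polynomial in one variable less.
    set P := MvPolynomial.finSuccEquiv ℝ n p with hP
    have hP0 : P ≠ 0 := by simpa [hP] using hp
    have hfin : {y : ℝ | P.eval (MvPolynomial.C y) = 0}.Finite := by
      refine Set.Finite.of_finite_image (f := MvPolynomial.C (σ := Fin n)) ?_
        (MvPolynomial.C_injective _ _).injOn
      refine (P.rootSet_finite (MvPolynomial (Fin n) ℝ)).subset ?_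
      rintro _ ⟨y, hy, rfl⟩
      rw [Polynomial.mem_rootSet]
      exact ⟨hP0, by simpa using hy⟩
    have hae : ∀ᵐ y : ℝ, P.eval (MvPolynomial.C y) ≠ 0 := by
      rw [ae_iff]
      simpa using hfin.measure_zero volume
    filter_upwards [hae] with y hy
    have ih := ae_mvPolynomial_eval_ne_zero _ hy
    rw [ae_iff] at ih
    simp only [ne_eq, not_not] at ih
    rw [Pi.zero_apply]
    convert ih using 3
    ext s
    simp only [Set.mem_preimage, Set.mem_ofPred_eq]
    have : MvPolynomial.eval s (P.eval (MvPolynomial.C y)) =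
        MvPolynomial.eval (Fin.cons y s : Fin (n + 1) → ℝ) p := by
      rw [MvPolynomial.eval_eq_eval_mv_eval', ← hP, Polynomial.eval_map,
        Polynomial.eval, Polynomial.hom_eval₂]
      simp
    have hcons : (MeasurableEquiv.piFinSuccAbove (fun _ : Fin (n + 1) => ℝ) 0).symm (y, s) =
        (Fin.cons y s : Fin (n + 1) → ℝ) := by
      simp only [MeasurableEquiv.piFinSuccAbove_symm_apply, Fin.insertNthEquiv_zero]
      rfl
    rw [this, hcons]

/-! ### Constant blocks in singular products of sets of matrices. -/

section BlockRank

variable {F ι : Type*} [Field F] [Fintype ι] [DecidableEq ι]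

/-- The span of the rows `I` of a matrix together with the unit vectors outside `J`. -/
def rowsModCols (A : Matrix ι ι F) (I J : Finset ι) : Submodule F (ι → F) :=
  Submodule.span F (A.row '' I) ⊔ Submodule.span F ((fun b => Pi.single b 1) '' (↑Jᶜ : Set ι))

theorem mem_span_single_compl (J : Finset ι) {v : ι → F} (hv : ∀ b ∈ J, v b = 0) :
    v ∈ Submodule.span F ((fun b => (Pi.single b 1 : ι → F)) '' (↑Jᶜ : Set ι)) := by
  have : v = ∑ b, v b • (Pi.single b 1 : ι → F) := by
    ext c
    simp [Finset.sum_apply, Pi.single_apply]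
  rw [this]
  refine Submodule.sum_mem _ fun b _ => ?_
  by_cases hb : b ∈ J
  · simp [hv b hb]
  · exact Submodule.smul_mem _ _ (Submodule.subset_span ⟨b, by simpa using hb, rfl⟩)

theorem rowsModCols_le_of_eqOn {A B : Matrix ι ι F} {I J : Finset ι}
    (h : ∀ a ∈ I, ∀ b ∈ J, A a b = B a b) : rowsModCols A I J ≤ rowsModCols B I J := by
  refine sup_le (Submodule.span_le.2 ?_) le_sup_right
  rintro _ ⟨a, ha, rfl⟩
  have : A.row a = B.row a + (A.row a - B.row a) := by abel
  rw [this]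
  refine Submodule.add_mem _
    (Submodule.mem_sup_left (Submodule.subset_span ⟨a, ha, rfl⟩))
    (Submodule.mem_sup_right (mem_span_single_compl J fun b hb => ?_))
  simp [h a ha b hb]

theorem rowsModCols_congr {A B : Matrix ι ι F} {I J : Finset ι}
    (h : ∀ a ∈ I, ∀ b ∈ J, A a b = B a b) : rowsModCols A I J = rowsModCols B I J :=
  le_antisymm (rowsModCols_le_of_eqOn h) (rowsModCols_le_of_eqOn fun a ha b hb => (h a ha b hb).symm)

/-- The first space on the left lies in the sum of the two spaces on the right and the second in
their intersection, so the dimension formula applies. -/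
theorem finrank_rowsModCols_submodular (A : Matrix ι ι F) (I₁ J₁ I₂ J₂ : Finset ι) :
    Module.finrank F (rowsModCols A (I₁ ∪ I₂) (J₁ ∩ J₂)) +
        Module.finrank F (rowsModCols A (I₁ ∩ I₂) (J₁ ∪ J₂)) ≤
      Module.finrank F (rowsModCols A I₁ J₁) + Module.finrank F (rowsModCols A I₂ J₂) := by
  rw [← Submodule.finrank_sup_add_finrank_inf_eq (rowsModCols A I₁ J₁)]
  refine add_le_add (Submodule.finrank_mono ?_) (Submodule.finrank_mono (le_inf ?_ ?_))
  · unfold rowsModCols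
    rw [Finset.compl_inter, Finset.coe_union, Finset.coe_union, Set.image_union, Set.image_union,
      Submodule.span_union, Submodule.span_union, sup_sup_sup_comm]
  all_goals
    refine sup_le_sup (Submodule.span_mono (Set.image_mono ?_))
      (Submodule.span_mono (Set.image_mono ?_)) <;> intro b <;> simp +contextual

/-- The determinant criterion of Hartfiel and Loewy for products of sets: if all the matrices
in a product of sets of entries are singular, then there is a block of constant entries of such a
small rank that no matrix with this block is invertible. -/
theorem exists_const_block_of_forall_det_eq_zero (U : Finset (ι × ι)) :
    ∀ Y : ι → ι → Set F, (∀ a b, (Y a b).Nonempty) →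
      (∀ a b, (a, b) ∉ U → (Y a b).Subsingleton) →
      (∀ A : Matrix ι ι F, (∀ a b, A a b ∈ Y a b) → A.det = 0) →
      ∃ I J : Finset ι, (∀ a ∈ I, ∀ b ∈ J, (Y a b).Subsingleton) ∧
        ∀ A : Matrix ι ι F, (∀ a b, A a b ∈ Y a b) →
          Module.finrank F (rowsModCols A I J) < I.card := by
  induction U using Finset.induction_on with
  | empty =>
    intro Y _ hU hdet
    refine ⟨Finset.univ, Finset.univ, fun a _ b _ => hU a b (by simp), fun A hA => ?_⟩
    have h0 := hdet A hA
    have hli : ¬ LinearIndependent F A.row := by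
      rw [Matrix.linearIndependent_rows_iff_isUnit, Matrix.isUnit_iff_isUnit_det, h0]
      simp
    rw [linearIndependent_iff_card_eq_finrank_span] at hli
    have hle := finrank_range_le_card (R := F) A.row
    have : rowsModCols A Finset.univ Finset.univ = Submodule.span F (Set.range A.row) := by
      simp [rowsModCols]
    rw [this, Finset.card_univ]
    exact lt_of_le_of_ne hle fun h => hli h.symm
  | insert e U _ ih =>
    obtain ⟨a, b⟩ := e
    intro Y hne hU hdet
    by_cases hs : (Y a b).Subsingleton
    · refine ih Y hne (fun a' b' h => ?_) hdet
      by_cases he : (a', b') = (a, b)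
      · cases he; exact hs
      · exact hU a' b' (by simp [he, h])
    obtain ⟨y, hy, y', hy', hyy⟩ := Set.not_subsingleton_iff.1 hs
    -- all the cofactors of the entry vanish
    have hcof : ∀ A : Matrix ι ι F, (∀ a b, A a b ∈ Y a b) →
        (A.updateRow a (Pi.single b 1)).det = 0 := by
      intro A hA
      have key : ∀ t ∈ Y a b, (A.updateRow a (Function.update (A a) b t)).det = 0 := by
        intro t ht
        refine hdet _ fun a' b' => ?_
        by_cases ha : a' = a
        · subst ha
          by_cases hb : b' = b
          · subst hb; simpa using ht
          · simpa [hb] using hA a' b'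
        · simpa [ha] using hA a' b'
      have hsplit : ∀ t, (A.updateRow a (Function.update (A a) b t)).det =
          (A.updateRow a (Function.update (A a) b 0)).det +
            t * (A.updateRow a (Pi.single b 1)).det := by
        intro t
        rw [← Matrix.det_updateRow_smul, ← Matrix.det_updateRow_add]
        congr 2
        ext b'
        by_cases hb : b' = b
        · subst hb; simp
        · simp [hb]
      have h1 := hsplit y
      have h2 := hsplit y'
      rw [key y hy] at h1
      rw [key y' hy'] at h2
      have h3 : (y - y') * (A.updateRow a (Pi.single b 1)).det = 0 := by linear_combination h2 - h1
      exact (mul_eq_zero.1 h3).resolve_left (sub_ne_zero.2 hyy)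
    -- Two smaller singular products: `Y₁` replaces row `a` by a unit vector, so that its
    -- determinant is the cofactor of the entry; `Y₂` freezes the entry at `y`. In both, one entry
    -- less is variable.
    let Y₁ : ι → ι → Set F := fun a' b' =>
      if a' = a then {(Pi.single b 1 : ι → F) b'} else Y a' b'
    let Y₂ : ι → ι → Set F := fun a' b' => if a' = a ∧ b' = b then {y} else Y a' b'
    obtain ⟨I₁, J₁, hs₁, hr₁⟩ := ih Y₁
      (fun a' b' => by
        by_cases ha : a' = a
        · simp [Y₁, ha]
        · simpa [Y₁, ha] using hne a' b')
      (fun a' b' h => by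
        by_cases ha : a' = a
        · simp [Y₁, ha]
        · simpa [Y₁, ha] using hU a' b' (by simp [ha, h]))
      (fun A hA => by
        have hrow : A a = Pi.single b 1 := by
          ext b'
          simpa [Y₁] using hA a b'
        choose B hB using hne
        have := hcof (A.updateRow a (B a)) fun a' b' => by
          by_cases ha : a' = a
          · subst ha; simpa using hB a' b'
          · simpa [ha, Y₁] using hA a' b'
        rw [Matrix.updateRow_idem, ← hrow, Matrix.updateRow_eq_self] at this
        exact this)
    obtain ⟨I₂, J₂, hs₂, hr₂⟩ := ih Y₂
      (fun a' b' => by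
        by_cases ha : a' = a ∧ b' = b
        · simp [Y₂, ha]
        · simpa [Y₂, ha] using hne a' b')
      (fun a' b' h => by
        by_cases ha : a' = a ∧ b' = b
        · simp [Y₂, ha]
        · simpa [Y₂, ha] using hU a' b' (by simp [ha, h]))
      (fun A hA => hdet A fun a' b' => by
        by_cases ha : a' = a ∧ b' = b
        · obtain ⟨rfl, rfl⟩ := ha
          have := hA a' b'
          simp only [Y₂, and_self, if_true, Set.mem_singleton_iff] at this
          rw [this]; exact hy
        · simpa [Y₂, ha] using hA a' b')
    by_cases haI₁ : a ∈ I₁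
    swap
    · refine ⟨I₁, J₁, fun a' ha b' hb => ?_, fun A hA => ?_⟩
      · have hne' : a' ≠ a := fun h => haI₁ (h ▸ ha)
        simpa [Y₁, hne'] using hs₁ a' ha b' hb
      · rw [rowsModCols_congr (B := A.updateRow a (Pi.single b 1)) fun a' ha b' _ => by
          have hne' : a' ≠ a := fun h => haI₁ (h ▸ ha)
          simp [hne']]
        refine hr₁ _ fun a' b' => ?_
        by_cases ha : a' = a
        · subst ha; simp [Y₁]
        · simpa [Y₁, ha] using hA a' b'
    by_cases hab : a ∈ I₂ ∧ b ∈ J₂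
    swap
    · refine ⟨I₂, J₂, fun a' ha b' hb => ?_, fun A hA => ?_⟩
      · have hne' : ¬ (a' = a ∧ b' = b) := by rintro ⟨rfl, rfl⟩; exact hab ⟨ha, hb⟩
        simpa [Y₂, hne'] using hs₂ a' ha b' hb
      · rw [rowsModCols_congr (B := A.updateRow a (Function.update (A a) b y)) fun a' ha b' hb => by
          by_cases h : a' = a
          · subst h
            have : b' ≠ b := by rintro rfl; exact hab ⟨ha, hb⟩
            simp [this]
          · simp [h]]
        refine hr₂ _ fun a' b' => ?_
        by_cases ha : a' = a
        · subst ha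
          by_cases hb : b' = b
          · subst hb; simp [Y₂]
          · simpa [Y₂, hb] using hA a' b'
        · simpa [Y₂, ha] using hA a' b'
    obtain ⟨haI₂, hbJ₂⟩ := hab
    set K₁ := I₁.erase a with hK₁
    set M₁ := J₁.erase b with hM₁
    have hfix₁ : ∀ a' ∈ K₁, ∀ b' ∈ M₁, (Y a' b').Subsingleton := by
      intro a' ha b' hb
      have := hs₁ a' (Finset.mem_of_mem_erase ha) b' (Finset.mem_of_mem_erase hb)
      simpa [Y₁, Finset.ne_of_mem_erase ha] using this
    have hcard₁ : K₁.card + 1 = I₁.card := Finset.card_erase_add_one haI₁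
    -- Deleting row `a` and column `b` costs one in the bound: the unit vector at `b`, now added as
    -- a vector outside the columns, was row `a` before.
    have hr₁' : ∀ A : Matrix ι ι F, (∀ a b, A a b ∈ Y a b) →
        Module.finrank F (rowsModCols A K₁ M₁) ≤ K₁.card := by
      intro A hA
      have h := hr₁ (A.updateRow a (Pi.single b 1)) fun a' b' => by
        by_cases ha : a' = a
        · subst ha; simp [Y₁]
        · simpa [Y₁, ha] using hA a' b'
      have hle : rowsModCols A K₁ M₁ ≤ rowsModCols (A.updateRow a (Pi.single b 1)) I₁ J₁ := by
        refine sup_le (Submodule.span_le.2 ?_) (Submodule.span_le.2 ?_)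
        · rintro _ ⟨a', ha, rfl⟩
          refine Submodule.mem_sup_left (Submodule.subset_span
            ⟨a', Finset.mem_of_mem_erase ha, ?_⟩)
          ext b'
          simp [Finset.ne_of_mem_erase ha]
        · rintro _ ⟨b', hb, rfl⟩
          by_cases h : b' = b
          · subst h
            refine Submodule.mem_sup_left (Submodule.subset_span ⟨a, haI₁, ?_⟩)
            ext b''
            simp
          · refine Submodule.mem_sup_right (Submodule.subset_span ⟨b', ?_, rfl⟩)
            simpa [hM₁, h] using hb
      have := Submodule.finrank_mono hle
      omega
    -- By submodularity the dimensions for (union, intersection) and (intersection, union) add up to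
    -- less than |K₁| + |I₂| = |K₁ ∪ I₂| + |K₁ ∩ I₂|. Neither block contains (a, b): the first
    -- misses column `b`, the second row `a`.
    have hr₂' : ∀ A : Matrix ι ι F, (∀ a b, A a b ∈ Y a b) →
        (Module.finrank F (rowsModCols A (K₁ ∪ I₂) (M₁ ∩ J₂)) < (K₁ ∪ I₂).card ∨
        Module.finrank F (rowsModCols A (K₁ ∩ I₂) (M₁ ∪ J₂)) < (K₁ ∩ I₂).card) := by
      intro A hA
      let A' := A.updateRow a (Function.update (A a) b y)
      have hA'Y : ∀ a' b', A' a' b' ∈ Y₂ a' b' := by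
        intro a' b'
        by_cases ha : a' = a
        · subst ha
          by_cases hb : b' = b
          · subst hb; simp [Y₂, A']
          · simpa [Y₂, hb, A'] using hA a' b'
        · simpa [Y₂, ha, A'] using hA a' b'
      have hA' : ∀ a' b', ¬ (a' = a ∧ b' = b) → A a' b' = A' a' b' := by
        intro a' b' h
        by_cases ha : a' = a
        · subst ha
          have hb : b' ≠ b := fun hb => h ⟨rfl, hb⟩
          simp [A', hb]
        · simp [A', ha]
      have e1 := rowsModCols_congr (I := K₁ ∪ I₂) (J := M₁ ∩ J₂) fun a' _ b' hb =>
        hA' a' b' fun h => by simp [hM₁, h.2] at hb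
      have e2 := rowsModCols_congr (I := K₁ ∩ I₂) (J := M₁ ∪ J₂) fun a' ha b' _ =>
        hA' a' b' fun h => by simp [hK₁, h.1] at ha
      have e3 := rowsModCols_congr (I := K₁) (J := M₁) fun a' ha b' _ =>
        hA' a' b' fun h => by simp [hK₁, h.1] at ha
      have h1 := hr₁' A hA
      have h2 := hr₂ A' hA'Y
      have h3 := finrank_rowsModCols_submodular A' K₁ M₁ I₂ J₂
      rw [← e1, ← e2, ← e3] at h3
      have h4 := Finset.card_union_add_card_inter K₁ I₂
      omega
    have hfix_u : ∀ a' ∈ K₁ ∪ I₂, ∀ b' ∈ M₁ ∩ J₂, (Y a' b').Subsingleton := by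
      intro a' ha b' hb
      rw [Finset.mem_inter] at hb
      rcases Finset.mem_union.1 ha with ha | ha
      · exact hfix₁ a' ha b' hb.1
      · have := hs₂ a' ha b' hb.2
        simpa [Y₂, Finset.ne_of_mem_erase hb.1] using this
    have hfix_i : ∀ a' ∈ K₁ ∩ I₂, ∀ b' ∈ M₁ ∪ J₂, (Y a' b').Subsingleton := by
      intro a' ha b' hb
      rw [Finset.mem_inter] at ha
      rcases Finset.mem_union.1 hb with hb | hb
      · exact hfix₁ a' ha.1 b' hb
      · have := hs₂ a' ha.2 b' hb
        simpa [Y₂, Finset.ne_of_mem_erase ha.1] using this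
    -- The alternative could depend on the matrix, but both blocks are constant on the product, so
    -- one representative decides it.
    choose B hB using hne
    rcases hr₂' B hB with h | h
    · refine ⟨_, _, hfix_u, fun A hA => ?_⟩
      rwa [rowsModCols_congr fun a ha b hb => hfix_u a ha b hb (hA a b) (hB a b)]
    · refine ⟨_, _, hfix_i, fun A hA => ?_⟩
      rwa [rowsModCols_congr fun a ha b hb => hfix_i a ha b hb (hA a b) (hB a b)]

/-- The rank of a block is at most the excess of the span of its rows modulo the other columns. -/
theorem rank_block_add_card_le (A : Matrix ι ι F) (I J : Finset ι) :
    (A.submatrix (fun a : I => (a : ι)) (fun b : J => (b : ι))).rank + Fintype.card ι ≤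
      Module.finrank F (rowsModCols A I J) + J.card := by
  let π : (ι → F) →ₗ[F] (J → F) := LinearMap.funLeft F F (fun b : J => (b : ι))
  let P := rowsModCols A I J
  have h1 := LinearMap.finrank_range_add_finrank_ker (π.domRestrict P)
  have h2 : (A.submatrix (fun a : I => (a : ι)) (fun b : J => (b : ι))).rank ≤
      Module.finrank F (LinearMap.range (π.domRestrict P)) := by
    rw [Matrix.rank_eq_finrank_span_row]
    refine Submodule.finrank_mono (Submodule.span_le.2 ?_)
    rintro _ ⟨a, rfl⟩
    exact ⟨⟨A.row a, Submodule.mem_sup_left (Submodule.subset_span ⟨a, a.2, rfl⟩)⟩, rfl⟩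
  have h3 : Jᶜ.card ≤ Module.finrank F (LinearMap.ker (π.domRestrict P)) := by
    let v : (Jᶜ : Finset ι) → LinearMap.ker (π.domRestrict P) := fun b =>
      ⟨⟨Pi.single (b : ι) 1, Submodule.mem_sup_right (Submodule.subset_span ⟨b, b.2, rfl⟩)⟩, by
        rw [LinearMap.mem_ker]
        ext c
        have : (c : ι) ≠ b := by
          rintro h
          have := b.2
          rw [Finset.mem_compl, ← h] at this
          exact this c.2
        simp [π, LinearMap.funLeft_apply, this]⟩
    have hv : LinearIndependent F v := by
      have h0 : LinearIndependent F fun b : (Jᶜ : Finset ι) => (Pi.single (b : ι) 1 : ι → F) :=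
        (Pi.linearIndependent_single_one ι F).comp _ Subtype.val_injective
      exact LinearIndependent.of_comp (P.subtype ∘ₗ (LinearMap.ker (π.domRestrict P)).subtype) h0
    rw [← Fintype.card_coe]
    exact hv.fintype_card_le_finrank
  have h4 := Finset.card_add_card_compl J
  change _ ≤ Module.finrank F P + _
  omega

end BlockRank

/-- Put t on the transversal and 1 on the other nonzero positions. The square part is t·I - N, whose
determinant is a characteristic polynomial in t; over an infinite field some t ≠ 0 is not a root,
and t ≠ 0 preserves the pattern. -/
theorem card_le_structuralRank {F m k κ : Type*} [Field F] [Infinite F] [Fintype m] [Fintype k]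
    [Fintype κ] (A : Matrix m k F) (r : κ → m) (c : κ → k) (hr : r.Injective) (hc : c.Injective)
    (h : ∀ x, A (r x) (c x) ≠ 0) : Fintype.card κ ≤ structuralRank A := by
  classical
  let N : Matrix κ κ F := Matrix.of fun x y => if x = y then 0 else if A (r x) (c y) = 0 then 0 else -1
  obtain ⟨t, ht⟩ : ∃ t : F, (X * N.charpoly).eval t ≠ 0 := by
    by_contra! h0
    exact mul_ne_zero X_ne_zero N.charpoly_monic.ne_zero (Polynomial.funext fun t => by simp [h0 t])
  rw [eval_mul, eval_X, mul_ne_zero_iff, Matrix.eval_charpoly] at ht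
  let B : Matrix m k F := Matrix.of fun a b =>
    if A a b = 0 then 0 else if ∃ x, r x = a ∧ c x = b then t else 1
  have hB : B.submatrix r c = Matrix.scalar κ t - N := by
    ext x y
    by_cases hxy : x = y
    · subst hxy
      have : ∃ x', r x' = r x ∧ c x' = c x := ⟨x, rfl, rfl⟩
      simp [B, N, h, this]
    · have : ¬ ∃ x', r x' = r x ∧ c x' = c y := by
        rintro ⟨x', h1, h2⟩
        exact hxy ((hr h1).symm.trans (hc h2))
      by_cases h0 : A (r x) (c y) = 0 <;> simp [B, N, this, hxy, h0, Matrix.scalar_apply]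
  have hrank : Fintype.card κ ≤ B.rank := by
    rw [← Matrix.rank_of_isUnit (Matrix.scalar κ t - N)
      ((Matrix.isUnit_iff_isUnit_det _).2 ht.2.isUnit), ← hB]
    exact Matrix.rank_submatrix_le _ _ _
  refine hrank.trans (le_csSup ⟨Fintype.card m, ?_⟩ ⟨B, fun a b => ?_, rfl⟩)
  · rintro _ ⟨B', -, rfl⟩
    exact B'.rank_le_card_height
  · by_cases h0 : A a b = 0
    · simp [B, h0]
    · by_cases h1 : ∃ x, r x = a ∧ c x = b <;> simp [B, h0, h1, ht.1]

/-! ### Generic nonsingularity of matrices of parameterized transfer functions. -/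

namespace RatParam

variable {n : ℕ}

/-- The parameterization of a constant. -/
def const (n : ℕ) (c : ℝ) : RatParam n := ⟨Polynomial.C (MvPolynomial.C c), 1⟩

theorem const_eval (c : ℝ) (θ : Fin n → ℝ) : (const n c).eval θ = RatFunc.C c := by
  simp [const, eval]

theorem const_den (c : ℝ) (θ : Fin n → ℝ) :
    (const n c).den.map (MvPolynomial.eval θ) ≠ 0 := by
  simp [const]

theorem const_params (c : ℝ) : (const n c).params = ∅ := by
  ext k
  simp only [params, const, Set.mem_ofPred_eq, Set.mem_empty_iff_false, iff_false, not_exists,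
    Polynomial.coeff_C, Polynomial.coeff_one]
  intro m
  split_ifs <;> simp

theorem map_congr {p : (MvPolynomial (Fin n) ℝ)[X]} {θ θ' : Fin n → ℝ}
    (h : ∀ m, ∀ k ∈ (p.coeff m).vars, θ k = θ' k) :
    p.map (MvPolynomial.eval θ) = p.map (MvPolynomial.eval θ') := by
  ext m
  rw [Polynomial.coeff_map, Polynomial.coeff_map]
  exact MvPolynomial.eval₂Hom_congr' rfl (fun k hk _ => h m k hk) rfl

theorem map_num_congr {p : RatParam n} {θ θ' : Fin n → ℝ} (h : ∀ k ∈ p.params, θ k = θ' k) :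
    p.num.map (MvPolynomial.eval θ) = p.num.map (MvPolynomial.eval θ') :=
  map_congr fun m k hk => h k ⟨m, Or.inl hk⟩

theorem map_den_congr {p : RatParam n} {θ θ' : Fin n → ℝ} (h : ∀ k ∈ p.params, θ k = θ' k) :
    p.den.map (MvPolynomial.eval θ) = p.den.map (MvPolynomial.eval θ') :=
  map_congr fun m k hk => h k ⟨m, Or.inr hk⟩

theorem eval_congr {p : RatParam n} {θ θ' : Fin n → ℝ} (h : ∀ k ∈ p.params, θ k = θ' k) :
    p.eval θ = p.eval θ' := by
  rw [eval, eval, map_num_congr h, map_den_congr h]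

/-- The transfer functions that a parameterization represents. -/
def values (p : RatParam n) : Set TF :=
  {f | ∃ θ, p.den.map (MvPolynomial.eval θ) ≠ 0 ∧ p.eval θ = f}

variable {ι : Type*} [Fintype ι] [DecidableEq ι]

/-- A nonzero polynomial in `z` over the polynomials in `θ` is nonzero for almost all `θ`. -/
theorem ae_map_eval_ne_zero {p : (MvPolynomial (Fin n) ℝ)[X]} (hp : p ≠ 0) :
    ∀ᵐ θ : Fin n → ℝ, p.map (MvPolynomial.eval θ) ≠ 0 := by
  filter_upwards [ae_mvPolynomial_eval_ne_zero _ (Polynomial.leadingCoeff_ne_zero.2 hp)] with θ hθ h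
  apply hθ
  have := congrArg (fun q => q.coeff p.natDegree) h
  simpa [Polynomial.coeff_map] using this

/-- A square matrix of independently parameterized transfer functions is either singular for all
parameters or nonsingular for almost all of them. -/
theorem forall_det_eq_zero_or_ae_ne_zero (q : ι → ι → RatParam n) :
    (∀ θ, (∀ a b, (q a b).den.map (MvPolynomial.eval θ) ≠ 0) →
      (Matrix.of fun a b => (q a b).eval θ).det = 0) ∨
    ∀ᵐ θ, (∀ a b, (q a b).den.map (MvPolynomial.eval θ) ≠ 0) →
      (Matrix.of fun a b => (q a b).eval θ).det ≠ 0 := by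
  -- Clearing denominators: every entry is multiplied by the product of all denominators, so `B`
  -- specializes to a nonzero scalar multiple of the matrix wherever no denominator vanishes.
  let B : Matrix ι ι (MvPolynomial (Fin n) ℝ)[X] := fun a b =>
    (q a b).num * ∏ e ∈ Finset.univ.erase (a, b), (q e.1 e.2).den
  have key : ∀ θ, (∀ a b, (q a b).den.map (MvPolynomial.eval θ) ≠ 0) →
      ((Matrix.of fun a b => (q a b).eval θ).det = 0 ↔
        B.det.map (MvPolynomial.eval θ) = 0) := by
    intro θ hθ
    let ψ : (MvPolynomial (Fin n) ℝ)[X] →+* TF :=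
      (algebraMap ℝ[X] TF).comp (Polynomial.mapRingHom (MvPolynomial.eval θ))
    have hψ : ∀ e : ι × ι, ψ (q e.1 e.2).den ≠ 0 := by
      intro e
      simpa [ψ] using hθ e.1 e.2
    have hmat : ψ.mapMatrix B =
        (∏ e : ι × ι, ψ (q e.1 e.2).den) • (Matrix.of fun a b => (q a b).eval θ) := by
      ext a b
      rw [RingHom.mapMatrix_apply, Matrix.map_apply, Matrix.smul_apply, Matrix.of_apply,
        smul_eq_mul, ← Finset.mul_prod_erase _ _ (Finset.mem_univ (a, b)), map_mul, map_prod]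
      have h1 : (q a b).eval θ = ψ (q a b).num / ψ (q a b).den := rfl
      have h2 := hψ (a, b)
      rw [h1]
      field_simp
    have hdet : ψ B.det = (∏ e : ι × ι, ψ (q e.1 e.2).den) ^ Fintype.card ι *
        (Matrix.of fun a b => (q a b).eval θ).det := by
      rw [RingHom.map_det, hmat, Matrix.det_smul]
    have hprod : (∏ e : ι × ι, ψ (q e.1 e.2).den) ^ Fintype.card ι ≠ 0 :=
      pow_ne_zero _ (Finset.prod_ne_zero_iff.2 fun e _ => hψ e)
    have h3 : B.det.map (MvPolynomial.eval θ) = 0 ↔ ψ B.det = 0 := by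
      simp [ψ]
    rw [h3, hdet, mul_eq_zero, or_iff_right hprod]
  by_cases hB : B.det = 0
  · left
    intro θ hθ
    rw [key θ hθ, hB, Polynomial.map_zero]
  · right
    filter_upwards [ae_map_eval_ne_zero hB] with θ h hθ
    rwa [Ne, key θ hθ]

/-- A square matrix of independently parameterized transfer functions is generically nonsingular if
all its constant blocks have a sufficiently large rank. -/
theorem ae_det_ne_zero (q : ι → ι → RatParam n)
    (hdisj : ∀ e f : ι × ι, e ≠ f → Disjoint (q e.1 e.2).params (q f.1 f.2).params)
    (θ₀ : Fin n → ℝ) (hden : ∀ a b, (q a b).den.map (MvPolynomial.eval θ₀) ≠ 0)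
    (hblock : ∀ I J : Finset ι, (∀ a ∈ I, ∀ b ∈ J, (q a b).values.Subsingleton) →
      I.card + J.card ≤ ((Matrix.of fun a b => (q a b).eval θ₀).submatrix
        (fun a : I => (a : ι)) (fun b : J => (b : ι))).rank + Fintype.card ι) :
    ∀ᵐ θ, (∀ a b, (q a b).den.map (MvPolynomial.eval θ) ≠ 0) →
      (Matrix.of fun a b => (q a b).eval θ).det ≠ 0 := by
  classical
  refine (forall_det_eq_zero_or_ae_ne_zero q).resolve_left fun hsing => ?_
  obtain ⟨I, J, hsub, hr⟩ := exists_const_block_of_forall_det_eq_zero Finset.univ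
    (fun a b => (q a b).values) (fun a b => ⟨_, θ₀, hden a b, rfl⟩)
    (fun a b h => absurd (Finset.mem_univ _) h) (fun A hA => by
      choose τ hτ hτA using hA
      -- Each entry comes with its own parameter vector. No parameter is shared, so these can be
      -- glued into one; the value 0 is for parameters that occur nowhere.
      let θ : Fin n → ℝ := fun k =>
        if h : ∃ e : ι × ι, k ∈ (q e.1 e.2).params then τ h.choose.1 h.choose.2 k else 0
      have hθ : ∀ a b, ∀ k ∈ (q a b).params, θ k = τ a b k := by
        intro a b k hk
        have h : ∃ e : ι × ι, k ∈ (q e.1 e.2).params := ⟨(a, b), hk⟩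
        have he : h.choose = (a, b) := by
          by_contra hne
          exact Set.disjoint_left.1 (hdisj _ _ hne) h.choose_spec hk
        simp only [θ, dif_pos h, he]
      have hA' : A = Matrix.of fun a b => (q a b).eval θ := by
        ext a b
        rw [Matrix.of_apply, eval_congr (hθ a b), hτA]
      rw [hA']
      refine hsing θ fun a b => ?_
      rw [map_den_congr (hθ a b)]
      exact hτ a b)
  have h1 := hr (Matrix.of fun a b => (q a b).eval θ₀) fun a b => ⟨θ₀, hden a b, rfl⟩
  have h2 := rank_block_add_card_le (Matrix.of fun a b => (q a b).eval θ₀) I J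
  have h3 := hblock I J hsub
  omega

end RatParam

/-! ### Submatrices of [G - I X] with a transversal. -/

namespace ModelSet

variable {L K n : ℕ} (M : ModelSet L K n)

/-- The parameterization of the entries of `[G - I  X]`. -/
def GIXpar (a : Fin L) : M.Vert → RatParam n
  | Sum.inl i => if a = i then RatParam.const n (-1) else M.Gpar a i
  | Sum.inr (Sum.inl k) => RatParam.const n (if a = M.rIn k then 1 else 0)
  | Sum.inr (Sum.inr c) => if h : a ∈ M.C then M.Hpar ⟨a, h⟩ c else RatParam.const n 0

variable {M}

theorem IsAdmissible.GIX_eq_eval (hadm : M.IsAdmissible) {θ : Fin n → ℝ} (hθ : θ ∈ M.Θ)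
    (a : Fin L) (v : M.Vert) : M.GIX θ a v = (M.GIXpar a v).eval θ := by
  rcases v with i | k | c
  · by_cases h : a = i
    · subst h
      simp [GIX, GIXpar, RatParam.const_eval, hadm.hollow_G θ hθ a]
    · simp [GIX, GIXpar, h, G]
  · by_cases h : a = M.rIn k <;> simp [GIX, GIXpar, X, R, h, RatParam.const_eval]
  · by_cases h : a ∈ M.C <;> simp [GIX, GIXpar, X, H, Hmeas, h, RatParam.const_eval]

theorem IsAdmissible.GIXpar_den_ne_zero (hadm : M.IsAdmissible) {θ : Fin n → ℝ} (hθ : θ ∈ M.Θ)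
    (a : Fin L) (v : M.Vert) : (M.GIXpar a v).den.map (MvPolynomial.eval θ) ≠ 0 := by
  rcases v with i | k | c
  · by_cases h : a = i
    · simpa [GIXpar, h] using RatParam.const_den _ _
    · simpa [GIXpar, h] using hadm.den_ne_G θ hθ a i
  · exact RatParam.const_den _ _
  · by_cases h : a ∈ M.C
    · simpa [GIXpar, h] using hadm.den_ne_H θ hθ ⟨a, h⟩ c
    · simpa [GIXpar, h] using RatParam.const_den _ _

theorem IndependentlyParameterized.disjoint_GIXpar (hind : M.IndependentlyParameterized)
    {a a' : Fin L} {v v' : M.Vert} (hne : (a, v) ≠ (a', v')) :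
    Disjoint (M.GIXpar a v).params (M.GIXpar a' v').params := by
  have key : ∀ a v, (M.GIXpar a v).params = ∅ ∨
      ∃ e, M.GIXpar a v = M.entryPar e ∧
        (match e with
          | Sum.inl e => (e.1, Sum.inl e.2)
          | Sum.inr e => ((e.1 : Fin L), Sum.inr (Sum.inr e.2))) = (a, v) := by
    intro a v
    rcases v with i | k | c
    · by_cases h : a = i
      · left; simp [GIXpar, h, RatParam.const_params]
      · right; exact ⟨Sum.inl (a, i), by simp [GIXpar, h, entryPar], rfl⟩
    · left; exact RatParam.const_params _
    · by_cases h : a ∈ M.C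
      · right; exact ⟨Sum.inr (⟨a, h⟩, c), by simp [GIXpar, h, entryPar], rfl⟩
      · left; simp [GIXpar, h, RatParam.const_params]
  rcases key a v with h | ⟨e, he, hea⟩
  · rw [h]; exact Set.empty_disjoint _
  rcases key a' v' with h | ⟨e', he', hea'⟩
  · rw [h]; exact Set.disjoint_empty _
  rw [he, he']
  refine hind e e' ?_
  rintro rfl
  exact hne (hea.symm.trans hea')

/-- A square submatrix of `[G - I  X]` with a transversal of entries that are not fixed to zero is
generically nonsingular. -/
theorem IsAdmissible.ae_det_submatrix_ne_zero (hadm : M.IsAdmissible)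
    (hind : M.IndependentlyParameterized) (hfix : M.FixedEntriesRegular)
    {ι : Type*} [Fintype ι] [DecidableEq ι] (f : ι ↪ Fin L) (g : ι ↪ M.Vert)
    (hfg : ∀ x, ∃ θ ∈ M.Θ, M.GIX θ (f x) (g x) ≠ 0) :
    ∀ᵐ θ : Fin n → ℝ, θ ∈ M.Θ → ((M.GIX θ).submatrix f g).det ≠ 0 := by
  rcases M.Θ.eq_empty_or_nonempty with hΘ | ⟨θ₀, hθ₀⟩
  · simp [hΘ]
  have hmat : ∀ θ ∈ M.Θ, (M.GIX θ).submatrix f g =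
      Matrix.of fun a b => (M.GIXpar (f a) (g b)).eval θ := by
    intro θ hθ
    ext a b
    exact hadm.GIX_eq_eval hθ _ _
  have hae := RatParam.ae_det_ne_zero (fun a b => M.GIXpar (f a) (g b))
    (fun e e' he => hind.disjoint_GIXpar fun h => he (by
      rw [Prod.mk.injEq] at h
      exact Prod.ext (f.injective h.1) (g.injective h.2)))
    θ₀ (fun a b => hadm.GIXpar_den_ne_zero hθ₀ _ _) (fun I J hIJ => by
      rw [← hmat θ₀ hθ₀]
      -- A block with a single value over all vectors with nonvanishing denominators is in
      -- particular fixed on Θ, where the rank assumption applies.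
      have hconst : ∀ θ ∈ M.Θ, ∀ θ' ∈ M.Θ, ∀ a ∈ I, ∀ b ∈ J,
          M.GIX θ (f a) (g b) = M.GIX θ' (f a) (g b) := by
        intro θ hθ θ' hθ' a ha b hb
        rw [hadm.GIX_eq_eval hθ, hadm.GIX_eq_eval hθ']
        exact hIJ a ha b hb ⟨θ, hadm.GIXpar_den_ne_zero hθ _ _, rfl⟩
          ⟨θ', hadm.GIXpar_den_ne_zero hθ' _ _, rfl⟩
      have hrank := hfix (I.map f) (J.map g) (fun θ hθ θ' hθ' a ha b hb => by
        obtain ⟨a', ha', rfl⟩ := Finset.mem_map.1 ha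
        obtain ⟨b', hb', rfl⟩ := Finset.mem_map.1 hb
        exact hconst θ hθ θ' hθ' a' ha' b' hb') θ₀ hθ₀
      -- Inside the block, the given transversal has the positions indexed by I ∩ J; these entries,
      -- nonzero for some parameter and fixed, are nonzero at θ₀. The bound required of the block
      -- then follows from |I| + |J| = |I ∪ J| + |I ∩ J|.
      have hle : (I ∩ J).card ≤ structuralRank ((M.GIX θ₀).submatrix
          (fun a : (I.map f : Finset _) => (a : Fin L))
          (fun b : (J.map g : Finset _) => (b : M.Vert))) := by
        rw [← Fintype.card_coe]
        refine card_le_structuralRank _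
          (fun x : (I ∩ J : Finset ι) =>
            ⟨f x, Finset.mem_map_of_mem f (Finset.mem_inter.1 x.2).1⟩)
          (fun x => ⟨g x, Finset.mem_map_of_mem g (Finset.mem_inter.1 x.2).2⟩)
          (fun x y h => Subtype.ext (f.injective (congrArg Subtype.val h)))
          (fun x y h => Subtype.ext (g.injective (congrArg Subtype.val h))) fun x => ?_
        obtain ⟨θ, hθ, h⟩ := hfg x
        rwa [hconst θ hθ θ₀ hθ₀ x (Finset.mem_inter.1 x.2).1 x (Finset.mem_inter.1 x.2).2] at h
      rw [← hrank] at hle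
      have hle2 : ((M.GIX θ₀).submatrix (fun a : (I.map f : Finset _) => (a : Fin L))
          (fun b : (J.map g : Finset _) => (b : M.Vert))).rank ≤
          (((M.GIX θ₀).submatrix f g).submatrix (fun a : I => (a : ι))
            (fun b : J => (b : ι))).rank := by
        have hI : ∀ a : (I.map f : Finset _), ∃ x : I, f x = a := fun a => by
          obtain ⟨x, hx, h⟩ := Finset.mem_map.1 a.2
          exact ⟨⟨x, hx⟩, h⟩
        have hJ : ∀ b : (J.map g : Finset _), ∃ x : J, g x = b := fun b => by
          obtain ⟨x, hx, h⟩ := Finset.mem_map.1 b.2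
          exact ⟨⟨x, hx⟩, h⟩
        choose r hr using hI
        choose c hc using hJ
        convert! Matrix.rank_submatrix_le (((M.GIX θ₀).submatrix f g).submatrix
          (fun a : I => (a : ι)) (fun b : J => (b : ι))) r c using 2
        ext a b
        simp [hr, hc]
      have h1 := Finset.card_union_add_card_inter I J
      have h2 := Finset.card_le_univ (I ∪ J)
      omega)
  filter_upwards [hae] with θ h hθ
  rw [hmat θ hθ]
  exact h fun a b => hadm.GIXpar_den_ne_zero hθ _ _

end ModelSet

/-! ### Disjoint path families and reachability. -/

section Paths

variable {V : Type*} {E : V → V → Prop} {A B D : Set V}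

/-- The successor relation of `k` vertex disjoint paths from `A` to `B`. -/
structure PathSystem (E : V → V → Prop) (A B : Set V) (k : ℕ) where
  /-- `v` follows `u` on one of the paths -/
  Next : V → V → Prop
  /-- the first vertices of the paths -/
  heads : Set V
  /-- the last vertices of the paths -/
  tails : Set V
  edge : ∀ {u v}, Next u v → E u v
  right_unique : ∀ {u v v'}, Next u v → Next u v' → v = v'
  left_unique : ∀ {u u' v}, Next u v → Next u' v → u = u'
  tail_or_next_iff : ∀ {u}, (u ∈ tails ∨ ∃ v, Next u v) ↔ (u ∈ heads ∨ ∃ v, Next v u)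
  not_next_of_tail : ∀ {u v}, u ∈ tails → ¬ Next u v
  not_next_of_head : ∀ {u v}, u ∈ heads → ¬ Next v u
  reaches_tail : ∀ {u v}, Next u v → ∃ t ∈ tails, Relation.ReflTransGen Next v t
  heads_subset : heads ⊆ A
  tails_subset : tails ⊆ B
  ncard_heads : heads.ncard = k
  ncard_tails : tails.ncard = k

/-- First vertices of disjoint paths are distinct. Boundedness ensures that the supremum in
`maxDisjointPaths` is attained. -/
theorem bddAbove_disjoint_paths [Finite V] (E : V → V → Prop) (A B : Set V) :
    BddAbove {k : ℕ | ∃ p : Fin k → List V,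
      (∀ a, IsPath E A B (p a)) ∧ ∀ a b, a ≠ b → (p a).Disjoint (p b)} := by
  refine ⟨Nat.card V, ?_⟩
  rintro k ⟨p, hp, hd⟩
  choose s _ hs using fun a => (hp a).2.2.1
  have hinj : Function.Injective s := by
    intro a b hab
    by_contra hne
    refine hd a b hne (List.mem_of_mem_head? (hs a)) ?_
    rw [hab]
    exact List.mem_of_mem_head? (hs b)
  simpa using Nat.card_le_card_of_injective s hinj

/-- In a disjoint family a vertex determines its path and its position on it (`huniq`), so the
successor relation is a partial injection. This form serves to build transversals without handling
lists. -/
theorem exists_pathSystem [Finite V] (E : V → V → Prop) (A B : Set V) :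
    Nonempty (PathSystem E A B (maxDisjointPaths E A B)) := by
  obtain ⟨p, hp, hd⟩ := Nat.sSup_mem (s := {k : ℕ | ∃ p : Fin k → List V,
      (∀ a, IsPath E A B (p a)) ∧ ∀ a b, a ≠ b → (p a).Disjoint (p b)})
    ⟨0, Fin.elim0, fun a => a.elim0, fun a => a.elim0⟩ (bddAbove_disjoint_paths E A B)
  change Fin (maxDisjointPaths E A B) → List V at p
  have huniq : ∀ {a b m l} (hm : m < (p a).length) (hl : l < (p b).length),
      (p a)[m] = (p b)[l] → a = b ∧ m = l := by
    intro a b m l hm hl h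
    have hab : a = b := by
      by_contra hne
      exact hd a b hne (List.getElem_mem hm) (h ▸ List.getElem_mem hl)
    subst hab
    exact ⟨rfl, (hp a).1.getElem_inj_iff.1 h⟩
  have hpos : ∀ a, 0 < (p a).length := by
    intro a
    obtain ⟨s, _, hs⟩ := (hp a).2.2.1
    exact List.length_pos_of_mem (List.mem_of_mem_head? hs)
  let hdv : Fin (maxDisjointPaths E A B) → V := fun a => (p a)[0]'(hpos a)
  let tlv : Fin (maxDisjointPaths E A B) → V := fun a =>
    (p a)[(p a).length - 1]'(Nat.sub_lt (hpos a) one_pos)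
  have hreach : ∀ a m (hm : m < (p a).length), Relation.ReflTransGen
      (fun u v => ∃ a m, ∃ h : m + 1 < (p a).length, (p a)[m] = u ∧ (p a)[m + 1] = v)
      (p a)[m] (tlv a) := by
    intro a m hm
    obtain ⟨d, hd'⟩ : ∃ d, d = (p a).length - 1 - m := ⟨_, rfl⟩
    induction d generalizing m with
    | zero =>
      have : m = (p a).length - 1 := by omega
      subst this
      exact Relation.ReflTransGen.refl
    | succ d ih =>
      exact Relation.ReflTransGen.head ⟨a, m, by omega, rfl, rfl⟩ (ih (m + 1) (by omega) (by omega))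
  refine ⟨{
    Next := fun u v => ∃ a m, ∃ h : m + 1 < (p a).length, (p a)[m] = u ∧ (p a)[m + 1] = v
    heads := Set.range hdv
    tails := Set.range tlv
    edge := ?_, right_unique := ?_, left_unique := ?_, tail_or_next_iff := ?_
    not_next_of_tail := ?_, not_next_of_head := ?_, reaches_tail := ?_
    heads_subset := ?_, tails_subset := ?_, ncard_heads := ?_, ncard_tails := ?_ }⟩
  · rintro _ _ ⟨a, m, h, rfl, rfl⟩
    exact List.isChain_iff_getElem.1 (hp a).2.1 m h
  · rintro u v v' ⟨a, m, h, hu, rfl⟩ ⟨b, l, h', hu', rfl⟩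
    obtain ⟨rfl, rfl⟩ := huniq _ _ (hu.trans hu'.symm)
    rfl
  · rintro u u' v ⟨a, m, h, rfl, hv⟩ ⟨b, l, h', rfl, hv'⟩
    obtain ⟨rfl, hml⟩ := huniq _ _ (hv.trans hv'.symm)
    obtain rfl : m = l := by omega
    rfl
  · intro u
    have h1 : (u ∈ Set.range tlv ∨ ∃ v, ∃ a m, ∃ h : m + 1 < (p a).length,
        (p a)[m] = u ∧ (p a)[m + 1] = v) ↔ ∃ a m, ∃ h : m < (p a).length, (p a)[m] = u := by
      constructor
      · rintro (⟨a, rfl⟩ | ⟨v, a, m, h, rfl, -⟩)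
        · exact ⟨a, _, _, rfl⟩
        · exact ⟨a, m, by omega, rfl⟩
      · rintro ⟨a, m, h, rfl⟩
        by_cases hm : m + 1 < (p a).length
        · exact Or.inr ⟨_, a, m, hm, rfl, rfl⟩
        · obtain rfl : m = (p a).length - 1 := by omega
          exact Or.inl ⟨a, rfl⟩
    have h2 : (u ∈ Set.range hdv ∨ ∃ v, ∃ a m, ∃ h : m + 1 < (p a).length,
        (p a)[m] = v ∧ (p a)[m + 1] = u) ↔ ∃ a m, ∃ h : m < (p a).length, (p a)[m] = u := by
      constructor
      · rintro (⟨a, rfl⟩ | ⟨v, a, m, h, -, rfl⟩)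
        · exact ⟨a, _, _, rfl⟩
        · exact ⟨a, m + 1, h, rfl⟩
      · rintro ⟨a, m, h, rfl⟩
        rcases m with _ | m
        · exact Or.inl ⟨a, rfl⟩
        · exact Or.inr ⟨_, a, m, h, rfl, rfl⟩
    exact h1.trans h2.symm
  · rintro _ v ⟨a, rfl⟩ ⟨b, m, h, hu, -⟩
    obtain ⟨rfl, hm⟩ := huniq _ _ hu
    omega
  · rintro _ v ⟨a, rfl⟩ ⟨b, m, h, -, hu⟩
    obtain ⟨rfl, hm⟩ := huniq _ _ hu
    omega
  · rintro u _ ⟨a, m, h, -, rfl⟩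
    exact ⟨tlv a, ⟨a, rfl⟩, hreach a (m + 1) h⟩
  · rintro _ ⟨a, rfl⟩
    obtain ⟨s, hs, hs'⟩ := (hp a).2.2.1
    have : hdv a = s := by
      rw [List.head?_eq_getElem?, List.getElem?_eq_getElem (hpos a)] at hs'
      exact Option.some.inj hs'
    rwa [this]
  · rintro _ ⟨a, rfl⟩
    obtain ⟨s, hs, hs'⟩ := (hp a).2.2.2
    have : tlv a = s := by
      rw [List.getLast?_eq_getElem?,
        List.getElem?_eq_getElem (Nat.sub_lt (hpos a) one_pos)] at hs'
      exact Option.some.inj hs'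
    rwa [this]
  · have : Function.Injective hdv := fun a b h => (huniq _ _ h).1
    rw [← Set.image_univ, Set.ncard_image_of_injective _ this, Set.ncard_univ, Nat.card_fin]
  · have : Function.Injective tlv := fun a b h => (huniq _ _ h).1
    rw [← Set.image_univ, Set.ncard_image_of_injective _ this, Set.ncard_univ, Nat.card_fin]

/-- A walk becomes a path by cutting loops: when the next vertex was visited before, the path is
truncated there. -/
theorem exists_path_of_reflTransGen {P : V → Prop} {a b : V} (ha : P a)
    (h : Relation.ReflTransGen (fun u v => E u v ∧ P v) a b) :
    ∃ p : List V, p.Nodup ∧ p.IsChain E ∧ p.head? = some a ∧ p.getLast? = some b ∧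
      ∀ v ∈ p, P v := by
  induction h with
  | refl => exact ⟨[a], by simp, by simp, rfl, rfl, by simpa using ha⟩
  | @tail b c _ hbc ih =>
    obtain ⟨p, hnd, hch, hhd, hlast, hP⟩ := ih
    by_cases hc : c ∈ p
    · obtain ⟨l₁, l₂, rfl⟩ := List.append_of_mem hc
      rw [List.append_cons] at hnd hch hhd hP
      refine ⟨l₁ ++ [c], (List.nodup_append.1 hnd).1, hch.left_of_append, ?_, by simp,
        fun v hv => hP v (List.mem_append_left _ hv)⟩
      rwa [List.head?_append_of_ne_nil _ (by simp)] at hhd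
    · have hne : p ≠ [] := by rintro rfl; simp at hhd
      refine ⟨p ++ [c], ?_, ?_, ?_, by simp, ?_⟩
      · exact List.nodup_append.2 ⟨hnd, by simp, by
          intro u hu v hv
          rw [List.mem_singleton] at hv
          rintro rfl
          exact hc (hv ▸ hu)⟩
      · refine hch.append (by simp) ?_
        intro u hu v hv
        rw [hlast] at hu
        simp only [Option.mem_def, Option.some.injEq, List.head?_cons] at hu hv
        subst hu hv
        exact hbc.1
      · rwa [List.head?_append_of_ne_nil _ hne]
      · intro v hv
        rcases List.mem_append.1 hv with hv | hv
        · exact hP v hv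
        · rw [List.mem_singleton] at hv
          subst hv
          exact hbc.2

/-- The vertices that can be reached from `A` without meeting `D`. -/
def reachableAvoiding (E : V → V → Prop) (A D : Set V) : Set V :=
  {v | ∃ a ∈ A, a ∉ D ∧ Relation.ReflTransGen (fun u v => E u v ∧ v ∉ D) a v}

theorem IsDisconnecting.notMem_reachableAvoiding (h : IsDisconnecting E A B D) {b : V}
    (hb : b ∈ B) : b ∉ reachableAvoiding E A D := by
  rintro ⟨a, ha, haD, hab⟩
  obtain ⟨p, h1, h2, h3, h4, h5⟩ := exists_path_of_reflTransGen (P := fun v => v ∉ D) haD hab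
  obtain ⟨v, hv, hvD⟩ := h p ⟨h1, h2, ⟨a, ha, h3⟩, ⟨b, hb, h4⟩⟩
  exact h5 v hv hvD

theorem mem_reachableAvoiding_of_edge {u v : V} (hu : u ∈ reachableAvoiding E A D) (huv : E u v)
    (hv : v ∉ D) : v ∈ reachableAvoiding E A D := by
  obtain ⟨a, ha, haD, hau⟩ := hu
  exact ⟨a, ha, haD, hau.tail ⟨huv, hv⟩⟩

theorem mem_reachableAvoiding {u : V} (hu : u ∈ A) (hD : u ∉ D) : u ∈ reachableAvoiding E A D :=
  ⟨u, hu, hD, Relation.ReflTransGen.refl⟩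

end Paths

/-! ### Matrix algebra for pairs of a transfer function and its limit or value. -/

section EntrywiseMem

variable {R S m k l : Type*} [CommRing R] [CommRing S]

/-- Two matrices whose pairs of corresponding entries belong to a subring of a product. -/
def EntrywiseMem (ρ : Subring (R × S)) (A : Matrix m k R) (B : Matrix m k S) : Prop :=
  ∀ a b, (A a b, B a b) ∈ ρ

variable {ρ : Subring (R × S)}

theorem EntrywiseMem.mul [Fintype k] {A : Matrix m k R} {B : Matrix m k S} {A' : Matrix k l R}
    {B' : Matrix k l S} (h : EntrywiseMem ρ A B) (h' : EntrywiseMem ρ A' B') :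
    EntrywiseMem ρ (A * A') (B * B') := by
  intro a b
  have : ((A * A') a b, (B * B') a b) = ∑ c, (A a c, B a c) * (A' c b, B' c b) := by
    ext <;> simp [Matrix.mul_apply, Prod.fst_sum, Prod.snd_sum]
  rw [this]
  exact Subring.sum_mem _ fun c _ => ρ.mul_mem (h a c) (h' c b)

theorem EntrywiseMem.one [DecidableEq m] :
    EntrywiseMem ρ (1 : Matrix m m R) (1 : Matrix m m S) := by
  intro a b
  by_cases h : a = b
  · subst h
    rw [Matrix.one_apply_eq, Matrix.one_apply_eq]
    exact ρ.one_mem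
  · rw [Matrix.one_apply_ne h, Matrix.one_apply_ne h]
    exact ρ.zero_mem

theorem EntrywiseMem.sub {A A' : Matrix m k R} {B B' : Matrix m k S}
    (h : EntrywiseMem ρ A B) (h' : EntrywiseMem ρ A' B') : EntrywiseMem ρ (A - A') (B - B') :=
  fun a b => ρ.sub_mem (h a b) (h' a b)

theorem EntrywiseMem.submatrix {A : Matrix m k R} {B : Matrix m k S} (h : EntrywiseMem ρ A B)
    {m' k' : Type*} (f : m' → m) (g : k' → k) :
    EntrywiseMem ρ (A.submatrix f g) (B.submatrix f g) :=
  fun a b => h (f a) (g b)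

/-- The matrix of pairs of entries. -/
def EntrywiseMem.pairs {A : Matrix m k R} {B : Matrix m k S} (h : EntrywiseMem ρ A B) :
    Matrix m k ρ :=
  Matrix.of fun a b => ⟨(A a b, B a b), h a b⟩

/-- The determinant is formed over the subring `ρ` itself; both projections are ring homomorphisms
and commute with it. -/
theorem EntrywiseMem.det [Fintype m] [DecidableEq m] {A : Matrix m m R} {B : Matrix m m S}
    (h : EntrywiseMem ρ A B) : (A.det, B.det) ∈ ρ := by
  have h1 := RingHom.map_det ((RingHom.fst R S).comp ρ.subtype) h.pairs
  have h2 := RingHom.map_det ((RingHom.snd R S).comp ρ.subtype) h.pairs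
  have : (A.det, B.det) = (h.pairs.det : R × S) := Prod.ext h1.symm h2.symm
  rw [this]
  exact h.pairs.det.2

theorem EntrywiseMem.adjugate [Fintype m] [DecidableEq m] {A : Matrix m m R} {B : Matrix m m S}
    (h : EntrywiseMem ρ A B) : EntrywiseMem ρ A.adjugate B.adjugate := by
  intro a b
  have h1 := congrFun₂ (RingHom.map_adjugate ((RingHom.fst R S).comp ρ.subtype) h.pairs) a b
  have h2 := congrFun₂ (RingHom.map_adjugate ((RingHom.snd R S).comp ρ.subtype) h.pairs) a b
  have : (A.adjugate a b, B.adjugate a b) = (h.pairs.adjugate a b : R × S) :=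
    Prod.ext h1.symm h2.symm
  rw [this]
  exact (h.pairs.adjugate a b).2

end EntrywiseMem

/-! ### Limits at infinity -/

namespace TF

section Limits

open scoped Classical

/-- Transfer functions together with their limits for `z → ∞`. -/
def limits : Subring (TF × ℝ) where
  carrier := {p | RatFunc.inftyValuation ℝ (p.1 - RatFunc.C p.2) < 1}
  zero_mem' := by simp
  one_mem' := by simp
  add_mem' {p q} hp hq := by
    have : (p + q).1 - RatFunc.C (p + q).2 =
        (p.1 - RatFunc.C p.2) + (q.1 - RatFunc.C q.2) := by
      simp only [Prod.fst_add, Prod.snd_add, map_add]; ring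
    simp only [Set.mem_ofPred_eq] at hp hq ⊢
    rw [this]
    exact Valuation.map_add_lt _ hp hq
  neg_mem' {p} hp := by
    have : (-p).1 - RatFunc.C (-p).2 = -(p.1 - RatFunc.C p.2) := by
      simp only [Prod.fst_neg, Prod.snd_neg, map_neg]; ring
    simp only [Set.mem_ofPred_eq] at hp ⊢
    rwa [this, Valuation.map_neg]
  mul_mem' {p q} hp hq := by
    have hC : ∀ c : ℝ, RatFunc.inftyValuation ℝ (RatFunc.C c) ≤ 1 := by
      intro c
      by_cases hc : c = 0
      · simp [hc]
      · exact (RatFunc.inftyValuation.C ℝ hc).le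
    simp only [Set.mem_ofPred_eq] at hp hq ⊢
    have hp1 : RatFunc.inftyValuation ℝ p.1 ≤ 1 := by
      have : p.1 = (p.1 - RatFunc.C p.2) + RatFunc.C p.2 := by ring
      rw [this]
      exact Valuation.map_add_le _ hp.le (hC _)
    have : (p * q).1 - RatFunc.C (p * q).2 =
        p.1 * (q.1 - RatFunc.C q.2) + RatFunc.C q.2 * (p.1 - RatFunc.C p.2) := by
      simp only [Prod.fst_mul, Prod.snd_mul, map_mul]; ring
    rw [this]
    refine Valuation.map_add_lt _ ?_ ?_
    · rw [map_mul]
      exact lt_of_le_of_lt (mul_le_of_le_one_left' hp1) hq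
    · rw [map_mul]
      exact lt_of_le_of_lt (mul_le_of_le_one_left' (hC _)) hp

theorem mem_limits {f : TF} {c : ℝ} :
    (f, c) ∈ limits ↔ RatFunc.inftyValuation ℝ (f - RatFunc.C c) < 1 := Iff.rfl

theorem C_mem_limits (c : ℝ) : (RatFunc.C c, c) ∈ limits := by simp [mem_limits]

theorem limits_unique {f : TF} {c d : ℝ} (hc : (f, c) ∈ limits) (hd : (f, d) ∈ limits) :
    c = d := by
  have h := limits.sub_mem hc hd
  rw [Prod.mk_sub_mk, sub_self, mem_limits, zero_sub, Valuation.map_neg] at h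
  by_contra hne
  rw [RatFunc.inftyValuation.C ℝ (sub_ne_zero.2 hne)] at h
  exact lt_irrefl _ h

theorem inftyValuation_algebraMap {p : ℝ[X]} (hp : p ≠ 0) :
    RatFunc.inftyValuation ℝ (algebraMap ℝ[X] TF p) = WithZero.exp (p.natDegree : ℤ) := by
  rw [RatFunc.inftyValuation_apply, RatFunc.inftyValuation.polynomial ℝ hp]

theorem IsProper.mem_limits {f : TF} (hf : f.IsProper) : (f, f.atInfinity) ∈ limits := by
  rw [TF.mem_limits]
  set r := f.num - Polynomial.C f.atInfinity * f.denom with hr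
  have hd : algebraMap ℝ[X] TF f.denom ≠ 0 := by simpa using f.denom_ne_zero
  have hfr : f - RatFunc.C f.atInfinity = algebraMap ℝ[X] TF r / algebraMap ℝ[X] TF f.denom := by
    nth_rewrite 1 [← f.num_div_denom]
    rw [hr, map_sub, map_mul, RatFunc.algebraMap_C]
    field_simp
  rw [hfr]
  by_cases hr0 : r = 0
  · simp [hr0]
  have hdeg : r.natDegree < f.denom.natDegree := by
    have hle : r.degree ≤ f.denom.degree := by
      refine (Polynomial.degree_sub_le _ _).trans (max_le hf ?_)
      rw [Polynomial.degree_mul]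
      exact (add_le_add Polynomial.degree_C_le le_rfl).trans (zero_add _).le
    refine lt_of_le_of_ne (Polynomial.natDegree_le_natDegree hle) fun h => ?_
    have h0 : r.coeff f.denom.natDegree = 0 := by
      rw [hr, Polynomial.coeff_sub, Polynomial.coeff_C_mul, Polynomial.coeff_natDegree,
        f.monic_denom.leadingCoeff, mul_one, atInfinity, sub_self]
    rw [← h, Polynomial.coeff_natDegree] at h0
    exact hr0 (Polynomial.leadingCoeff_eq_zero.1 h0)
  rw [map_div₀, inftyValuation_algebraMap hr0, inftyValuation_algebraMap f.denom_ne_zero,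
    ← WithZero.exp_sub, ← WithZero.exp_zero, WithZero.exp_lt_exp]
  omega

/-- A nonzero limit forces valuation one, so the difference of the inverses has the same valuation
as the difference itself. -/
theorem inv_mem_limits {f : TF} {c : ℝ} (h : (f, c) ∈ limits) (hc : c ≠ 0) :
    (f⁻¹, c⁻¹) ∈ limits := by
  have hC := RatFunc.inftyValuation.C ℝ hc
  have hv : RatFunc.inftyValuation ℝ f = 1 := by
    rw [← hC]
    exact Valuation.map_eq_of_sub_lt _ (by rw [hC]; exact h)
  have hf : f ≠ 0 := by rintro rfl; simp at hv
  have hc' : RatFunc.C c ≠ 0 := by simpa using hc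
  rw [mem_limits]
  have : f⁻¹ - RatFunc.C c⁻¹ = -(f - RatFunc.C c) * (f⁻¹ * (RatFunc.C c)⁻¹) := by
    rw [map_inv₀]
    field_simp
    ring
  rw [this, map_mul, map_mul, map_inv₀, map_inv₀, hv, hC, Valuation.map_neg]
  simpa using mem_limits.1 h

theorem natDegree_num_le_of_mem_limits {f : TF} {c : ℝ} (h : (f, c) ∈ limits) :
    f.num.natDegree ≤ f.denom.natDegree := by
  by_cases hf : f = 0
  · simp [hf]
  have hv : RatFunc.inftyValuation ℝ f ≤ 1 := by
    have : f = (f - RatFunc.C c) + RatFunc.C c := by ring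
    rw [this]
    refine Valuation.map_add_le _ (mem_limits.1 h).le ?_
    by_cases hc : c = 0
    · simp [hc]
    · exact (RatFunc.inftyValuation.C ℝ hc).le
  rw [RatFunc.inftyValuation_apply, RatFunc.inftyValuation_of_nonzero ℝ hf,
    ← WithZero.exp_zero, WithZero.exp_le_exp] at hv
  unfold RatFunc.intDegree at hv
  omega

end Limits

end TF

theorem EntrywiseMem.inv_limits {m : Type*} [Fintype m] [DecidableEq m] {A : Matrix m m TF}
    {B : Matrix m m ℝ} (h : EntrywiseMem TF.limits A B) (hB : B.det ≠ 0) :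
    EntrywiseMem TF.limits A⁻¹ B⁻¹ := by
  intro a b
  rw [Matrix.inv_def, Matrix.inv_def, Ring.inverse_eq_inv', Ring.inverse_eq_inv']
  exact TF.limits.mul_mem (TF.inv_mem_limits h.det hB) (h.adjugate a b)

theorem EntrywiseMem.det_ne_zero_of_limits {m : Type*} [Fintype m] [DecidableEq m]
    {A : Matrix m m TF} {B : Matrix m m ℝ} (h : EntrywiseMem TF.limits A B) (hB : B.det ≠ 0) :
    A.det ≠ 0 := by
  intro h0
  have := h.det
  rw [h0] at this
  exact hB (TF.limits_unique this TF.limits.zero_mem)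

/-! ### Linear relations between responses, from separation and from disjoint paths. -/

namespace ModelSet

variable {L K n : ℕ} {M : ModelSet L K n} {θ : Fin n → ℝ}

theorem IsAdmissible.limits_one_sub_G (hadm : M.IsAdmissible) (hθ : θ ∈ M.Θ) :
    EntrywiseMem TF.limits (1 - M.G θ) (1 - M.Ginf θ) :=
  EntrywiseMem.one.sub fun a b => (hadm.proper_G θ hθ a b).mem_limits

theorem IsAdmissible.det_one_sub_Ginf_ne_zero (hadm : M.IsAdmissible) (hθ : θ ∈ M.Θ) :
    (1 - M.Ginf θ).det ≠ 0 := by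
  have h := hadm.wellPosed θ hθ Finset.univ
  let e : Fin L ≃ (Finset.univ : Finset (Fin L)) := (Equiv.subtypeUnivEquiv (by simp)).symm
  rwa [← Matrix.det_submatrix_equiv_self e, Matrix.submatrix_submatrix] at h

theorem IsAdmissible.det_one_sub_G_ne_zero (hadm : M.IsAdmissible) (hθ : θ ∈ M.Θ) :
    (1 - M.G θ).det ≠ 0 :=
  (hadm.limits_one_sub_G hθ).det_ne_zero_of_limits (hadm.det_one_sub_Ginf_ne_zero hθ)

theorem IsAdmissible.one_sub_G_mul_T (hadm : M.IsAdmissible) (hθ : θ ∈ M.Θ) :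
    (1 - M.G θ) * M.T θ = 1 :=
  Matrix.mul_nonsing_inv _ (hadm.det_one_sub_G_ne_zero hθ).isUnit

theorem IsAdmissible.T_mul_one_sub_G (hadm : M.IsAdmissible) (hθ : θ ∈ M.Θ) :
    M.T θ * (1 - M.G θ) = 1 :=
  Matrix.nonsing_inv_mul _ (hadm.det_one_sub_G_ne_zero hθ).isUnit

variable (M) in
/-- The transfer matrix `[T X; I]` from the external signals to all the signals. -/
def resp (θ : Fin n → ℝ) : Matrix M.Vert M.Ext TF := Matrix.fromRows (M.T θ * M.X θ) 1

theorem IsAdmissible.GIX_mul_resp (hadm : M.IsAdmissible) (hθ : θ ∈ M.Θ) :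
    M.GIX θ * M.resp θ = 0 := by
  have h : M.G θ - 1 = -(1 - M.G θ) := by abel
  rw [GIX, resp, Matrix.fromCols_mul_fromRows, ← Matrix.mul_assoc, h, Matrix.neg_mul,
    hadm.one_sub_G_mul_T hθ, Matrix.mul_one, Matrix.neg_mul, Matrix.one_mul, neg_add_cancel]

theorem GIX_eq_edgeTF {v : M.Vert} {a : Fin L} (h : v ≠ Sum.inl a) :
    M.GIX θ a v = M.edgeTF θ v a := by
  rcases v with i | y
  · have : a ≠ i := by rintro rfl; exact h rfl
    simp [GIX, edgeTF, Matrix.one_apply_ne this]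
  · rfl

theorem IsAdmissible.GIX_self (hadm : M.IsAdmissible) (hθ : θ ∈ M.Θ) (a : Fin L) :
    M.GIX θ a (Sum.inl a) = -1 := by
  simp [GIX, hadm.hollow_G θ hθ a]

theorem GIX_eq_zero_of_not_edge (hθ : θ ∈ M.Θ) {v : M.Vert} {a : Fin L} (h : v ≠ Sum.inl a)
    (hE : ¬ M.Edge v (Sum.inl a)) : M.GIX θ a v = 0 := by
  rw [GIX_eq_edgeTF h]
  by_contra h0
  exact hE ⟨θ, hθ, h0⟩

theorem IsAdmissible.ne_of_edge (hadm : M.IsAdmissible) {v : M.Vert} {a : Fin L}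
    (h : M.Edge v (Sum.inl a)) : v ≠ Sum.inl a := by
  rintro rfl
  obtain ⟨θ, hθ, h0⟩ := h
  exact h0 (hadm.hollow_G θ hθ a)

theorem IsAdmissible.exists_GIX_ne_zero_of_edge (hadm : M.IsAdmissible) {v : M.Vert} {a : Fin L}
    (h : M.Edge v (Sum.inl a)) : ∃ θ ∈ M.Θ, M.GIX θ a v ≠ 0 := by
  have hne := hadm.ne_of_edge h
  obtain ⟨θ, hθ, h0⟩ := h
  exact ⟨θ, hθ, by rwa [GIX_eq_edgeTF hne]⟩

/-- A linear functional of the responses to `A` that vanishes on a set `D` which disconnects `A`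
from the signals `Z` vanishes on `Z`. -/
theorem IsAdmissible.eq_zero_of_not_reachable (hadm : M.IsAdmissible) (hθ : θ ∈ M.Θ)
    {A D : Set M.Vert} {y : M.Vert → TF} (hy : M.GIX θ *ᵥ y = 0)
    (hyA : ∀ x : M.Ext, Sum.inr x ∉ A → y (Sum.inr x) = 0)
    (hyD : ∀ v ∈ D, y v = 0) (k : Fin L)
    (hk : (Sum.inl k : M.Vert) ∉ reachableAvoiding M.Edge A D) : y (Sum.inl k) = 0 := by
  classical
  by_cases hkD : (Sum.inl k : M.Vert) ∈ D
  · exact hyD _ hkD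
  -- `Z` is closed for the equations: a reachable vertex has no edge into it, and `y` vanishes on
  -- `D` and on external signals outside `A`. What remains is a principal submatrix of I - G,
  -- nonsingular by well-posedness.
  let Z : Finset (Fin L) := Finset.univ.filter fun k =>
    (Sum.inl k : M.Vert) ∉ reachableAvoiding M.Edge A D ∧ (Sum.inl k : M.Vert) ∉ D
  have hdet : ((1 - M.G θ).submatrix (fun a : Z => (a : Fin L)) (fun a : Z => (a : Fin L))).det
      ≠ 0 :=
    ((hadm.limits_one_sub_G hθ).submatrix _ _).det_ne_zero_of_limits (hadm.wellPosed θ hθ Z)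
  have hzero : ((1 - M.G θ).submatrix (fun a : Z => (a : Fin L)) (fun a : Z => (a : Fin L))) *ᵥ
      (fun a : Z => y (Sum.inl (a : Fin L))) = 0 := by
    ext a
    obtain ⟨haN, haD⟩ := (Finset.mem_filter.1 a.2).2
    have ha : ∑ v, M.GIX θ a v * y v = 0 := congrFun hy a
    have hvanish : ∀ v : M.Vert, (∀ b ∈ Z, v ≠ Sum.inl b) → M.GIX θ a v * y v = 0 := by
      intro v hv
      by_cases hvD : v ∈ D
      · rw [hyD v hvD, mul_zero]
      by_cases hvN : v ∈ reachableAvoiding M.Edge A D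
      · rw [GIX_eq_zero_of_not_edge hθ (hv a a.2) fun hE =>
          haN (mem_reachableAvoiding_of_edge hvN hE haD), zero_mul]
      rcases v with b | x
      · exact absurd rfl (hv b (by simp [Z, hvN, hvD]))
      · rw [hyA x fun hx => hvN (mem_reachableAvoiding hx hvD), mul_zero]
    rw [Fintype.sum_sum_type,
      Finset.sum_eq_zero (fun x _ => hvanish (Sum.inr x) (by simp)), add_zero,
      ← Finset.sum_subset (Finset.subset_univ Z) (fun b _ hb => hvanish (Sum.inl b) (by
        rintro b' hb' h
        exact hb (Sum.inl_injective h ▸ hb'))), ← Finset.sum_coe_sort] at ha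
    change ∑ b : Z, (1 - M.G θ) a b * y (Sum.inl (b : Fin L)) = 0
    rw [← neg_eq_zero, ← ha, ← Finset.sum_neg_distrib]
    refine Finset.sum_congr rfl fun b _ => ?_
    simp only [GIX, Matrix.fromCols_apply_inl, Matrix.sub_apply]
    ring
  have := Matrix.eq_zero_of_mulVec_eq_zero hdet hzero
  exact congrFun this ⟨k, by simp [Z, hk, hkD]⟩

/-- If `D` disconnects `A` from `B` and there are `|D|` disjoint paths from `D` to `B`, then
generically a linear functional of the responses to `A` that vanishes on `B` vanishes on `D`. -/
theorem IsAdmissible.ae_eq_zero_of_eq_zero_on_target (hadm : M.IsAdmissible)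
    (hind : M.IndependentlyParameterized) (hfix : M.FixedEntriesRegular)
    {A B : Set M.Vert} {D : Finset M.Vert} (hdisc : IsDisconnecting M.Edge A B (D : Set M.Vert))
    (hpaths : maxDisjointPaths M.Edge (D : Set M.Vert) B = D.card) :
    ∀ᵐ θ : Fin n → ℝ, θ ∈ M.Θ → ∀ y : M.Vert → TF, M.GIX θ *ᵥ y = 0 →
      (∀ x : M.Ext, Sum.inr x ∉ A → y (Sum.inr x) = 0) → (∀ v ∈ B, y v = 0) →
      ∀ v ∈ D, y v = 0 := by
  classical
  rcases M.Θ.eq_empty_or_nonempty with hΘ | ⟨θ₀, hθ₀⟩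
  · simp [hΘ]
  obtain ⟨S⟩ := exists_pathSystem M.Edge (D : Set M.Vert) B
  rw [hpaths] at S
  have hheads : S.heads = (D : Set M.Vert) :=
    Set.eq_of_subset_of_ncard_le S.heads_subset
      (by rw [S.ncard_heads, Set.ncard_coe_finset]) D.finite_toSet
  set N := reachableAvoiding M.Edge A (D : Set M.Vert) with hN
  have hstep : ∀ {u v}, S.Next u v → v ∉ D := fun h hv =>
    S.not_next_of_head (by rw [hheads]; exact hv) h
  -- All of `D` is used as heads, so a path never returns to `D`; if it met `N` after its head, its
  -- end in `B` would be reachable without meeting `D`.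
  have hnextN : ∀ {u v}, S.Next u v → v ∉ N := by
    intro u v huv hvN
    obtain ⟨t, ht, hvt⟩ := S.reaches_tail huv
    have htN : t ∈ N := by
      clear ht
      induction hvt with
      | refl => exact hvN
      | tail _ h ih => exact mem_reachableAvoiding_of_edge ih (S.edge h) (hstep h)
    exact hdisc.notMem_reachableAvoiding (S.tails_subset ht) htN
  let ι := {v : M.Vert // ((∃ k, v = Sum.inl k ∧ v ∉ N) ∨ v ∈ D) ∧ v ∉ B}
  let on : Set M.Vert := {u | u ∈ S.tails ∨ ∃ v, S.Next u v}
  -- The transversal: a column on a path is matched with the row of its successor, any other column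
  -- with its own diagonal entry. The rows avoid `N` and `D`, so their equations involve no vertex
  -- of `N`.
  have hψ : ∀ v : ι, ∃ a : Fin L, (Sum.inl a : M.Vert) ∉ N ∧ (Sum.inl a : M.Vert) ∉ D ∧
      (S.Next v (Sum.inl a) ∨ v.1 = Sum.inl a ∧ v.1 ∉ on) := by
    rintro ⟨v, hv, hvB⟩
    by_cases hon : v ∈ on
    · obtain ⟨u, hu⟩ := hon.resolve_left fun h => hvB (S.tails_subset h)
      have hE := S.edge hu
      rcases u with a | x
      · exact ⟨a, hnextN hu, hstep hu, Or.inl hu⟩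
      · exact hE.elim
    · have hvD : v ∉ D := fun h => hon (S.tail_or_next_iff.2 (Or.inl (by rw [hheads]; exact h)))
      obtain ⟨a, rfl, haN⟩ := hv.resolve_right hvD
      exact ⟨a, haN, hvD, Or.inr ⟨rfl, hon⟩⟩
  choose ψ hψN hψD hψ using hψ
  have hψinj : Function.Injective ψ := by
    intro v v' h
    have h1 := hψ v
    have h2 := hψ v'
    rw [← h] at h2
    have hon : ∀ {u}, S.Next u (Sum.inl (ψ v)) → (Sum.inl (ψ v) : M.Vert) ∈ on := fun h =>
      S.tail_or_next_iff.2 (Or.inr ⟨_, h⟩)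
    rcases h1 with h1 | ⟨h1, h1'⟩ <;> rcases h2 with h2 | ⟨h2, h2'⟩
    · exact Subtype.ext (S.left_unique h1 h2)
    · exact absurd (hon h1) (h2 ▸ h2')
    · exact absurd (hon h2) (h1 ▸ h1')
    · exact Subtype.ext (h1.trans h2.symm)
  have hae := hadm.ae_det_submatrix_ne_zero hind hfix (ι := ι) ⟨ψ, hψinj⟩
    ⟨Subtype.val, Subtype.val_injective⟩ fun v => by
      rcases hψ v with h | ⟨h, -⟩
      · exact hadm.exists_GIX_ne_zero_of_edge (S.edge h)
      · refine ⟨θ₀, hθ₀, ?_⟩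
        simp only [Function.Embedding.coeFn_mk]
        rw [h, hadm.GIX_self hθ₀]
        simp
  filter_upwards [hae] with θ hdet hθ y hy hyA hyB v hv
  have hzero : (M.GIX θ).submatrix ψ Subtype.val *ᵥ (fun v : ι => y v) = 0 := by
    ext a
    have ha : ∑ v, M.GIX θ (ψ a) v * y v = 0 := congrFun hy (ψ a)
    change ∑ v : ι, M.GIX θ (ψ a) v * y v = 0
    rw [← ha]
    have hs := Finset.sum_subset (Finset.subset_univ (Finset.univ.map
      (⟨Subtype.val, Subtype.val_injective⟩ : ι ↪ M.Vert)))
      (f := fun u => M.GIX θ (ψ a) u * y u) (fun u _ hu => by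
        have huι : ¬ (((∃ k, u = Sum.inl k ∧ u ∉ N) ∨ u ∈ D) ∧ u ∉ B) := by
          intro h
          exact hu (Finset.mem_map.2 ⟨⟨u, h⟩, Finset.mem_univ _, rfl⟩)
        by_cases huB : u ∈ B
        · rw [hyB u huB, mul_zero]
        have huD : u ∉ D := fun h => huι ⟨Or.inr h, huB⟩
        by_cases huN : u ∈ N
        · rw [GIX_eq_zero_of_not_edge hθ (fun h => hψN a (h ▸ huN)) fun hE =>
            hψN a (mem_reachableAvoiding_of_edge huN hE (hψD a)), zero_mul]
        rcases u with k | x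
        · exact absurd ⟨Or.inl ⟨k, rfl, huN⟩, huB⟩ huι
        · rw [hyA x fun hx => huN (mem_reachableAvoiding hx huD), mul_zero])
    rw [← hs, Finset.sum_map]
    rfl
  by_cases hvB : v ∈ B
  · exact hyB v hvB
  · exact congrFun (Matrix.eq_zero_of_mulVec_eq_zero (hdet hθ) hzero) ⟨v, Or.inr hv, hvB⟩

/-- If there are `|B|` disjoint paths from external signals `A` to `B`, then generically the
responses of `B` to `A` are linearly independent. -/
theorem IsAdmissible.ae_linearIndependent_resp (hadm : M.IsAdmissible)
    (hind : M.IndependentlyParameterized) (hfix : M.FixedEntriesRegular)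
    {A : Set M.Vert} (hA : ∀ k, (Sum.inl k : M.Vert) ∉ A) {B : Finset M.Vert}
    (hpaths : B.card ≤ maxDisjointPaths M.Edge A (B : Set M.Vert)) :
    ∀ᵐ θ : Fin n → ℝ, θ ∈ M.Θ → ∀ c : M.Vert → TF, (∀ v ∉ B, c v = 0) →
      (∀ x : M.Ext, Sum.inr x ∈ A → (c ᵥ* M.resp θ) x = 0) → c = 0 := by
  classical
  rcases M.Θ.eq_empty_or_nonempty with hΘ | ⟨θ₀, hθ₀⟩
  · simp [hΘ]
  obtain ⟨S⟩ := exists_pathSystem M.Edge A (B : Set M.Vert)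
  have htails : S.tails = (B : Set M.Vert) :=
    Set.eq_of_subset_of_ncard_le S.tails_subset
      (by rwa [S.ncard_tails, Set.ncard_coe_finset]) B.finite_toSet
  let on : Set M.Vert := {u | u ∈ S.heads ∨ ∃ v, S.Next v u}
  have hBon : ∀ v ∈ B, v ∈ on := fun v hv => S.tail_or_next_iff.1 (Or.inl (by rw [htails]; exact hv))
  have hnextB : ∀ {u v}, S.Next u v → u ∉ B := fun h hu => S.not_next_of_tail (by rw [htails]; exact hu) h
  have hext : ∀ x : M.Ext, (Sum.inr x : M.Vert) ∈ on → (Sum.inr x : M.Vert) ∈ A := by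
    rintro x (h | ⟨v, h⟩)
    · exact S.heads_subset h
    · exact (S.edge h).elim
  -- Dual matching: the row of a signal on a path is matched with the column of its predecessor, any
  -- other row with its diagonal entry. All these columns avoid `B`, where `c` may be nonzero.
  have hπ : ∀ a : Fin L, ∃ v : M.Vert, v ∉ B ∧ (∀ x, v = Sum.inr x → v ∈ A) ∧
      (S.Next v (Sum.inl a) ∨ v = Sum.inl a ∧ (Sum.inl a : M.Vert) ∉ on) := by
    intro a
    by_cases hon : (Sum.inl a : M.Vert) ∈ on
    · obtain ⟨v, hv⟩ := hon.resolve_left fun h => hA a (S.heads_subset h)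
      refine ⟨v, hnextB hv, ?_, Or.inl hv⟩
      rintro x rfl
      exact hext x (S.tail_or_next_iff.1 (Or.inr ⟨_, hv⟩))
    · exact ⟨Sum.inl a, fun h => hon (hBon _ h), by simp, Or.inr ⟨rfl, hon⟩⟩
  choose π hπB hπA hπ using hπ
  have hπinj : Function.Injective π := by
    intro a a' h
    have h1 := hπ a
    have h2 := hπ a'
    rw [← h] at h2
    have hon : ∀ {u}, S.Next (π a) u → π a ∈ on := fun h =>
      S.tail_or_next_iff.1 (Or.inr ⟨_, h⟩)
    rcases h1 with h1 | ⟨h1, h1'⟩ <;> rcases h2 with h2 | ⟨h2, h2'⟩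
    · exact Sum.inl_injective (S.right_unique h1 h2)
    · exact absurd (hon h1) (h2 ▸ h2')
    · exact absurd (hon h2) (h1 ▸ h1')
    · exact Sum.inl_injective (h1.symm.trans h2)
  have hae := hadm.ae_det_submatrix_ne_zero hind hfix (Function.Embedding.refl (Fin L))
    ⟨π, hπinj⟩ fun a => by
      rcases hπ a with h | ⟨h, -⟩
      · exact hadm.exists_GIX_ne_zero_of_edge (S.edge h)
      · refine ⟨θ₀, hθ₀, ?_⟩
        simp only [Function.Embedding.coeFn_mk, Function.Embedding.refl_apply]
        rw [h, hadm.GIX_self hθ₀]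
        simp
  filter_upwards [hae] with θ hdet hθ c hcB hc
  -- With this `u`, the product with [G - I X] is `-c` on internal columns and, by the assumed
  -- relation, on external columns in `A`. It thus vanishes on the matched columns, so `u = 0` and
  -- then `c = 0`.
  let u : Fin L → TF := (fun k => c (Sum.inl k)) ᵥ* M.T θ
  have hu1 : ∀ k, (u ᵥ* M.GIX θ) (Sum.inl k) = -c (Sum.inl k) := by
    intro k
    have h1 : u ᵥ* (1 - M.G θ) = fun k => c (Sum.inl k) := by
      rw [Matrix.vecMul_vecMul, hadm.T_mul_one_sub_G hθ, Matrix.vecMul_one]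
    have h2 : (u ᵥ* M.GIX θ) (Sum.inl k) = (u ᵥ* -(1 - M.G θ)) k := by
      rw [neg_sub, GIX, Matrix.vecMul_fromCols]; rfl
    rw [h2, Matrix.vecMul_neg, h1, Pi.neg_apply]
  have hu2 : ∀ x : M.Ext, Sum.inr x ∈ A → (u ᵥ* M.GIX θ) (Sum.inr x) = -c (Sum.inr x) := by
    intro x hx
    have h1 : (u ᵥ* M.GIX θ) (Sum.inr x) = ((fun k => c (Sum.inl k)) ᵥ* (M.T θ * M.X θ)) x := by
      rw [← Matrix.vecMul_vecMul, GIX, Matrix.vecMul_fromCols]; rfl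
    have h2 := hc x hx
    have h3 : c = Sum.elim (fun k => c (Sum.inl k)) (fun x => c (Sum.inr x)) := by
      ext v; rcases v with v | v <;> rfl
    rw [resp, h3, Matrix.sumElim_vecMul_fromRows, Matrix.vecMul_one, Pi.add_apply] at h2
    rw [h1]
    exact eq_neg_of_add_eq_zero_left h2
  have hu : u = 0 := by
    refine Matrix.eq_zero_of_vecMul_eq_zero (hdet hθ) ?_
    ext a
    change (u ᵥ* M.GIX θ) (π a) = 0
    have hB := hcB _ (hπB a)
    have hAa := hπA a
    rcases hv : π a with k | x
    · rw [hu1, ← hv, hB, neg_zero]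
    · rw [hu2 x (hv ▸ hAa x hv), ← hv, hB, neg_zero]
  ext v
  rcases v with k | x
  · have := hu1 k
    rw [hu, Matrix.zero_vecMul, Pi.zero_apply] at this
    simpa using this.symm
  · by_cases hx : (Sum.inr x : M.Vert) ∈ B
    · have := hu2 x (hext x (hBon _ hx))
      rw [hu, Matrix.zero_vecMul, Pi.zero_apply] at this
      simpa using this.symm
    · exact hcB _ hx

end ModelSet

/-! ### Values on the unit circle -/

namespace TF

/-- Transfer functions without pole at `z` together with their values at `z`. -/
def values (z : ℂ) : Subring (TF × ℂ) where
  carrier := {p | aeval z p.1.denom ≠ 0 ∧ RatFunc.eval (algebraMap ℝ ℂ) z p.1 = p.2}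
  zero_mem' := by simp
  one_mem' := by simp
  add_mem' {p q} hp hq := by
    simp only [Set.mem_ofPred_eq] at hp hq ⊢
    refine ⟨fun h => ?_, ?_⟩
    · have := aeval_eq_zero_of_dvd_aeval_eq_zero (RatFunc.denom_add_dvd p.1 q.1) h
      rw [map_mul] at this
      exact (mul_ne_zero hp.1 hq.1) this
    · rw [Prod.fst_add, RatFunc.eval_add (algebraMap ℝ ℂ) z hp.1 hq.1, hp.2, hq.2, Prod.snd_add]
  mul_mem' {p q} hp hq := by
    simp only [Set.mem_ofPred_eq] at hp hq ⊢
    refine ⟨fun h => ?_, ?_⟩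
    · have := aeval_eq_zero_of_dvd_aeval_eq_zero (RatFunc.denom_mul_dvd p.1 q.1) h
      rw [map_mul] at this
      exact (mul_ne_zero hp.1 hq.1) this
    · rw [Prod.fst_mul, RatFunc.eval_mul (algebraMap ℝ ℂ) z hp.1 hq.1, hp.2, hq.2, Prod.snd_mul]
  neg_mem' {p} hp := by
    simp only [Set.mem_ofPred_eq] at hp ⊢
    have hneg : (-p).1 = RatFunc.C (-1) * p.1 := by simp
    have h1 : eval₂ (algebraMap ℝ ℂ) z (RatFunc.C (-1 : ℝ)).denom ≠ 0 := by
      rw [RatFunc.denom_C]; simp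
    rw [hneg]
    refine ⟨fun h => ?_, ?_⟩
    · have := aeval_eq_zero_of_dvd_aeval_eq_zero (RatFunc.denom_mul_dvd _ p.1) h
      rw [map_mul] at this
      exact (mul_ne_zero h1 hp.1) this
    · rw [RatFunc.eval_mul (algebraMap ℝ ℂ) z h1 hp.1, hp.2, RatFunc.eval_C]
      simp

theorem mem_values {z : ℂ} {f : TF} {c : ℂ} : (f, c) ∈ values z ↔
    aeval z f.denom ≠ 0 ∧ RatFunc.eval (algebraMap ℝ ℂ) z f = c := Iff.rfl

theorem C_mem_values (z : ℂ) (c : ℝ) : (RatFunc.C c, (c : ℂ)) ∈ values z := by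
  rw [mem_values, RatFunc.denom_C, RatFunc.eval_C]
  simp

/-- The coefficients are real. On the unit circle this turns conjugation of values into the
reflection z ↦ 1/z. -/
theorem conj_mem_values {z : ℂ} {f : TF} {c : ℂ} (h : (f, c) ∈ values z) :
    (f, (starRingEnd ℂ) c) ∈ values ((starRingEnd ℂ) z) := by
  have key : ∀ p : ℝ[X], aeval ((starRingEnd ℂ) z) p = (starRingEnd ℂ) (aeval z p) := by
    intro p
    have := Polynomial.aeval_algHom_apply Complex.conjAe.toAlgHom z p
    simpa using this
  rw [mem_values] at h ⊢
  refine ⟨by rw [key]; simpa using h.1, ?_⟩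
  rw [← h.2, RatFunc.eval, RatFunc.eval, ← aeval_def, ← aeval_def, ← aeval_def, ← aeval_def, key,
    key, map_div₀]

/-- The point of the unit circle at frequency `ω`. -/
def circlePt (ω : ℝ) : ℂ := Complex.exp (Complex.I * (ω : ℂ))

theorem norm_circlePt (ω : ℝ) : ‖circlePt ω‖ = 1 := by
  rw [circlePt, mul_comm]; exact Complex.norm_exp_ofReal_mul_I ω

theorem circlePt_ne_zero (ω : ℝ) : circlePt ω ≠ 0 := Complex.exp_ne_zero _

theorem conj_circlePt (ω : ℝ) : (starRingEnd ℂ) (circlePt ω) = (circlePt ω)⁻¹ :=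
  (Complex.inv_eq_conj (norm_circlePt ω)).symm

theorem continuous_circlePt : Continuous circlePt := by
  unfold circlePt; fun_prop

theorem countable_setOf_aeval_circlePt_eq_zero {p : ℝ[X]} (hp : p ≠ 0) :
    {ω : ℝ | aeval (circlePt ω) p = 0}.Countable := by
  have hfin : (p.rootSet ℂ).Finite := p.rootSet_finite ℂ
  have hsub : {ω : ℝ | aeval (circlePt ω) p = 0} ⊆ ⋃ w ∈ p.rootSet ℂ, {ω | circlePt ω = w} := by
    intro ω hω
    simp only [Set.mem_iUnion]
    exact ⟨circlePt ω, (Polynomial.mem_rootSet.2 ⟨hp, hω⟩), rfl⟩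
  refine Set.Countable.mono hsub (hfin.countable.biUnion fun w _ => ?_)
  rcases Set.eq_empty_or_nonempty {ω | circlePt ω = w} with h | ⟨ω₀, h₀⟩
  · rw [h]; exact Set.countable_empty
  · refine (Set.countable_range fun k : ℤ => ω₀ + k * (2 * Real.pi)).mono ?_
    intro ω hω
    have h : circlePt ω = circlePt ω₀ := Eq.trans hω (Eq.symm h₀)
    obtain ⟨k, hk⟩ := Complex.exp_eq_exp_iff_exists_int.1 h
    refine ⟨k, ?_⟩
    have h2 : Complex.I * (ω : ℂ) = Complex.I * ((ω₀ + k * (2 * Real.pi) : ℝ) : ℂ) := by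
      rw [hk]; push_cast; ring
    exact (Complex.ofReal_injective (mul_left_cancel₀ Complex.I_ne_zero h2)).symm

/-- A proper transfer function without poles outside the closed unit disc that is bounded on the
unit circle and agrees there with `g (1 / z)` for another such function `g` is constant. -/
theorem eq_C_of_reflection {f g : TF} {c d : ℝ} (hf : (f, c) ∈ limits) (hg : (g, d) ∈ limits)
    (hfp : ∀ z : ℂ, aeval z f.denom = 0 → ‖z‖ ≤ 1) (hgp : ∀ z : ℂ, aeval z g.denom = 0 → ‖z‖ ≤ 1)
    {s : Set ℝ} (hs : s.Countable) (K : ℝ)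
    (h : ∀ ω ∉ s, ∃ y, (f, y) ∈ values (circlePt ω) ∧ (g, y) ∈ values (circlePt ω)⁻¹ ∧ ‖y‖ ≤ K) :
    f = RatFunc.C c := by
  set N := g.denom.natDegree with hN
  have hnum : g.num.natDegree ≤ N := natDegree_num_le_of_mem_limits hg
  -- The identity f(z) = g(1/z) cleared of denominators; properness of `g` lets its numerator be
  -- reflected at the same degree `N`. A nonzero polynomial vanishes at only countably many
  -- frequencies.
  have hpoly : f.num * reflect N g.denom - f.denom * reflect N g.num = 0 := by
    by_contra hne
    have hsub : (Set.univ : Set ℝ) ⊆ s ∪ {ω : ℝ | aeval (circlePt ω)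
        (f.num * reflect N g.denom - f.denom * reflect N g.num) = 0} := by
      intro ω _
      by_cases hω : ω ∈ s
      · exact Or.inl hω
      right
      obtain ⟨y, ⟨hf1, hf2⟩, ⟨hg1, hg2⟩, -⟩ := h ω hω
      simp only at hf1 hf2 hg1 hg2
      set z := circlePt ω
      have hz : z ≠ 0 := circlePt_ne_zero ω
      let _ : Invertible z⁻¹ := invertibleOfNonzero (inv_ne_zero hz)
      have r1 := eval₂_reflect_mul_pow (algebraMap ℝ ℂ) z⁻¹ N g.denom le_rfl
      have r2 := eval₂_reflect_mul_pow (algebraMap ℝ ℂ) z⁻¹ N g.num hnum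
      rw [invOf_eq_inv, inv_inv] at r1 r2
      rw [RatFunc.eval, ← r1, ← r2] at hg2
      rw [aeval_def, ← r1] at hg1
      have hzN : z⁻¹ ^ N ≠ 0 := pow_ne_zero _ (inv_ne_zero hz)
      rw [mul_div_mul_right _ _ hzN, div_eq_iff (left_ne_zero_of_mul hg1)] at hg2
      rw [aeval_def] at hf1
      rw [RatFunc.eval, div_eq_iff hf1] at hf2
      simp only [Set.mem_ofPred_eq, map_sub, map_mul, aeval_def]
      rw [hf2, hg2]
      ring
    exact Cardinal.not_countable_real
      ((hs.union (countable_setOf_aeval_circlePt_eq_zero hne)).mono hsub)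
  have hdvd : f.denom ∣ reflect N g.denom := by
    refine (RatFunc.isCoprime_num_denom f).symm.dvd_of_dvd_mul_left ?_
    exact ⟨_, sub_eq_zero.1 hpoly⟩
  -- Unlike the bound on `f`, this one makes sense at poles and extends by continuity to the
  -- exceptional frequencies.
  have hbound : ∀ ω, ‖aeval (circlePt ω) f.num‖ ≤ K * ‖aeval (circlePt ω) f.denom‖ := by
    have hclosed : IsClosed {ω : ℝ |
        ‖aeval (circlePt ω) f.num‖ ≤ K * ‖aeval (circlePt ω) f.denom‖} := by
      refine isClosed_le ?_ ?_
      · exact ((Polynomial.continuous_aeval _).comp continuous_circlePt).norm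
      · exact continuous_const.mul ((Polynomial.continuous_aeval _).comp continuous_circlePt).norm
    have hdense := hs.dense_compl ℝ
    have hsub : sᶜ ⊆ {ω : ℝ | ‖aeval (circlePt ω) f.num‖ ≤ K * ‖aeval (circlePt ω) f.denom‖} := by
      intro ω hω
      obtain ⟨y, ⟨hf1, hf2⟩, -, hy⟩ := h ω hω
      simp only at hf1 hf2
      rw [aeval_def] at hf1
      rw [RatFunc.eval, div_eq_iff hf1] at hf2
      simp only [Set.mem_ofPred_eq, aeval_def]
      rw [hf2, norm_mul]
      exact mul_le_mul_of_nonneg_right hy (norm_nonneg _)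
    intro ω
    have := hclosed.closure_subset_iff.2 hsub
    rw [hdense.closure_eq] at this
    exact this (Set.mem_univ ω)
  have hden : f.denom = 1 := by
    by_contra hne
    have hdeg : f.denom.degree ≠ 0 := by
      intro h0
      exact hne (f.monic_denom.degree_le_zero_iff_eq_one.1 h0.le)
    obtain ⟨z, hz⟩ := IsAlgClosed.exists_aeval_eq_zero ℂ f.denom hdeg
    -- A pole z of `f` has |z| ≤ 1, and 1/z is a pole of `g`, so |z| = 1. There the bound makes the
    -- numerator vanish too, against coprimality.
    have hz1 := hfp z hz
    have hrefl : aeval z (reflect N g.denom) = 0 := aeval_eq_zero_of_dvd_aeval_eq_zero hdvd hz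
    have hz0 : z ≠ 0 := by
      rintro rfl
      have h0 : (reflect N g.denom).coeff 0 = 1 := by
        rw [coeff_reflect, revAt_zero, hN, coeff_natDegree, g.monic_denom.leadingCoeff]
      rw [aeval_def, eval₂_at_zero, h0] at hrefl
      simp at hrefl
    let _ : Invertible z⁻¹ := invertibleOfNonzero (inv_ne_zero hz0)
    have hinv := (eval₂_reflect_eq_zero_iff (algebraMap ℝ ℂ) z⁻¹ N g.denom le_rfl).1
      (by rwa [invOf_eq_inv, inv_inv])
    have hz2 := hgp z⁻¹ hinv
    rw [norm_inv, inv_le_one₀ (norm_pos_iff.2 hz0)] at hz2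
    obtain ⟨ω, hω⟩ := (Complex.norm_eq_one_iff z).1 (le_antisymm hz1 hz2)
    have hzω : circlePt ω = z := by rw [circlePt, mul_comm, hω]
    have hb := hbound ω
    rw [hzω, hz, norm_zero, mul_zero, norm_le_zero_iff] at hb
    obtain ⟨u, v, huv⟩ := RatFunc.isCoprime_num_denom f
    have := congrArg (aeval z) huv
    rw [map_add, map_mul, map_mul, hb, hz] at this
    simp at this
  have hnum0 : f.num.natDegree ≤ 0 := by
    have := natDegree_num_le_of_mem_limits hf
    rwa [hden, natDegree_one] at this
  have hfC : f = RatFunc.C (f.num.coeff 0) := by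
    conv_lhs => rw [← f.num_div_denom, hden, map_one, div_one,
      Polynomial.eq_C_of_natDegree_le_zero hnum0, RatFunc.algebraMap_C]
  rw [hfC] at hf
  rw [hfC, limits_unique hf (C_mem_limits _)]

end TF

/-! ### Uniqueness of minimum phase spectral factors. -/

section SpectralFactor

variable {m k : Type*}

theorem EntrywiseMem.of_values {A : Matrix m k TF} {z : ℂ}
    (h : ∀ a b, aeval z (A a b).denom ≠ 0) :
    EntrywiseMem (TF.values z) A (A.map (RatFunc.eval (algebraMap ℝ ℂ) z)) :=
  fun a b => ⟨h a b, rfl⟩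

theorem EntrywiseMem.values_unique {A : Matrix m k TF} {B B' : Matrix m k ℂ} {z : ℂ}
    (h : EntrywiseMem (TF.values z) A B) (h' : EntrywiseMem (TF.values z) A B') : B = B' := by
  ext a b
  exact (h a b).2.symm.trans (h' a b).2

theorem EntrywiseMem.C_values (A : Matrix m k ℝ) (z : ℂ) :
    EntrywiseMem (TF.values z) (A.map RatFunc.C) (A.map (fun x : ℝ => (x : ℂ))) :=
  fun a b => TF.C_mem_values z (A a b)

theorem EntrywiseMem.C_limits (A : Matrix m k ℝ) : EntrywiseMem TF.limits (A.map RatFunc.C) A :=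
  fun a b => TF.C_mem_limits (A a b)

theorem EntrywiseMem.transpose {R S : Type*} [CommRing R] [CommRing S] {ρ : Subring (R × S)}
    {A : Matrix m k R} {B : Matrix m k S} (h : EntrywiseMem ρ A B) : EntrywiseMem ρ Aᵀ Bᵀ :=
  fun a b => h b a

variable [Fintype m] [DecidableEq m]

theorem map_ofReal_mul_eq_one {A B : Matrix m m ℝ} (h : A * B = 1) :
    A.map (fun x : ℝ => (x : ℂ)) * B.map (fun x : ℝ => (x : ℂ)) = 1 := by
  have := congrArg (fun A : Matrix m m ℝ => A.map Complex.ofRealHom) h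
  rw [Matrix.map_mul, Matrix.map_one _ (map_zero _) (map_one _)] at this
  exact this

theorem exists_eq_mul_transpose_of_posSemidef {A : Matrix m m ℝ} (hA : A.PosSemidef) :
    ∃ B : Matrix m m ℝ, A = B * Bᵀ := by
  open scoped MatrixOrder Matrix.Norms.L2Operator in
  obtain ⟨B, rfl⟩ := CStarAlgebra.nonneg_iff_eq_star_mul_self.mp hA.nonneg
  exact ⟨Bᵀ, by simp [Matrix.star_eq_conjTranspose, Matrix.conjTranspose_eq_transpose_of_trivial]⟩

/-- The matrices `Y` with `Y Λ₀ Yᴴ = Λ₁` for a positive definite `Λ₀` are uniformly bounded. -/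
theorem exists_bound_of_mul_mul_conjTranspose_eq {Λ₀ : Matrix m m ℝ} (hΛ₀ : Λ₀.PosDef)
    (Λ₁ : Matrix m m ℂ) : ∃ K : ℝ, ∀ Y : Matrix m m ℂ,
      Y * Λ₀.map (fun x : ℝ => (x : ℂ)) * Yᴴ = Λ₁ → ∀ a b, ‖Y a b‖ ≤ K := by
  obtain ⟨B, hB⟩ := exists_eq_mul_transpose_of_posSemidef hΛ₀.posSemidef
  have hdet : B.det ≠ 0 := by
    intro h0
    have := hΛ₀.det_pos
    rw [hB, Matrix.det_mul, h0, zero_mul] at this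
    exact lt_irrefl _ this
  let Bc : Matrix m m ℂ := B.map (fun x : ℝ => (x : ℂ))
  let Bi : Matrix m m ℂ := B⁻¹.map (fun x : ℝ => (x : ℂ))
  have hBi : Bc * Bi = 1 :=
    map_ofReal_mul_eq_one (Matrix.mul_nonsing_inv _ hdet.isUnit)
  have hΛc : Λ₀.map (fun x : ℝ => (x : ℂ)) = Bc * Bcᴴ := by
    have := congrArg (fun A : Matrix m m ℝ => A.map Complex.ofRealHom) hB
    rw [Matrix.map_mul] at this
    have hT : Bcᴴ = Bᵀ.map Complex.ofRealHom := by
      ext a b; simp [Bc]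
    rw [hT]
    exact this
  -- With Λ₀ = B Bᵀ, the rows of Z = Y B have squared norms equal to the diagonal of Λ₁. The summand
  -- 1 + ‖Λ₁ a a‖ dominates the square root, and summing over a and b makes the constant uniform.
  refine ⟨∑ a, ∑ b, ∑ c, (1 + ‖Λ₁ a a‖) * ‖Bi c b‖, fun Y hY a b => ?_⟩
  let Z := Y * Bc
  have hZ : Z * Zᴴ = Λ₁ := by
    rw [← hY, hΛc, Matrix.conjTranspose_mul]
    simp only [Z, Matrix.mul_assoc]
  have hYZ : Y = Z * Bi := by
    rw [Matrix.mul_assoc, hBi, Matrix.mul_one]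
  have hZb : ∀ c, ‖Z a c‖ ≤ 1 + ‖Λ₁ a a‖ := by
    intro c
    have h1 : Λ₁ a a = ((∑ d, ‖Z a d‖ ^ 2 : ℝ) : ℂ) := by
      rw [← hZ, Matrix.mul_apply, Complex.ofReal_sum]
      refine Finset.sum_congr rfl fun d _ => ?_
      rw [Matrix.conjTranspose_apply]
      have := Complex.mul_conj' (Z a d)
      simpa using this
    have h2 : ‖Z a c‖ ^ 2 ≤ ‖Λ₁ a a‖ := by
      rw [h1, Complex.norm_real]
      refine le_trans ?_ (le_abs_self _)
      exact Finset.single_le_sum (f := fun d => ‖Z a d‖ ^ 2) (fun d _ => sq_nonneg _)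
        (Finset.mem_univ c)
    nlinarith [norm_nonneg (Z a c), norm_nonneg (Λ₁ a a)]
  calc ‖Y a b‖ ≤ ∑ c, (1 + ‖Λ₁ a a‖) * ‖Bi c b‖ := by
        rw [hYZ, Matrix.mul_apply]
        refine (norm_sum_le _ _).trans (Finset.sum_le_sum fun c _ => ?_)
        rw [norm_mul]
        exact mul_le_mul_of_nonneg_right (hZb c) (norm_nonneg _)
    _ ≤ ∑ b, ∑ c, (1 + ‖Λ₁ a a‖) * ‖Bi c b‖ :=
        Finset.single_le_sum (f := fun b => ∑ c, (1 + ‖Λ₁ a a‖) * ‖Bi c b‖)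
          (fun b _ => by positivity) (Finset.mem_univ b)
    _ ≤ _ := Finset.single_le_sum (f := fun a => ∑ b, ∑ c, (1 + ‖Λ₁ a a‖) * ‖Bi c b‖)
          (fun b _ => by positivity) (Finset.mem_univ a)

/-- Stable minimum phase spectral factors of the same spectrum differ by a constant matrix. -/
theorem spectralFactor_unique {W₀ W₁ : Matrix m m TF} {Λ₀ Λ₁ B₀ B₁ : Matrix m m ℝ}
    (hst₀ : ∀ a b, TF.IsStable (W₀ a b)) (hst₁ : ∀ a b, TF.IsStable (W₁ a b))
    (hmin₀ : IsMinimumPhase W₀) (hmin₁ : IsMinimumPhase W₁)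
    (hlim₀ : EntrywiseMem TF.limits W₀ B₀) (hlim₁ : EntrywiseMem TF.limits W₁ B₁)
    (hB₀ : B₀.det ≠ 0) (hB₁ : B₁.det ≠ 0) (hΛ₀ : Λ₀.PosDef)
    (hspec : ∀ ω : ℝ, W₀.map (TF.freq · ω) * Λ₀.map (fun x : ℝ => (x : ℂ)) *
        (W₀.map (TF.freq · ω))ᴴ =
      W₁.map (TF.freq · ω) * Λ₁.map (fun x : ℝ => (x : ℂ)) * (W₁.map (TF.freq · ω))ᴴ) :
    W₀ = W₁ * (B₁⁻¹ * B₀).map RatFunc.C ∧ (B₁⁻¹ * B₀) * Λ₀ * (B₁⁻¹ * B₀)ᵀ = Λ₁ := by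
  set Q := W₁⁻¹ * W₀ with hQ
  set P := W₀⁻¹ * W₁ with hP
  have hWW₀ : W₀⁻¹ * W₀ = 1 := Matrix.nonsing_inv_mul _ hmin₀.1
  have hWW₁ : W₁⁻¹ * W₁ = 1 := Matrix.nonsing_inv_mul _ hmin₁.1
  have hWW₁' : W₁ * W₁⁻¹ = 1 := Matrix.mul_nonsing_inv _ hmin₁.1
  have hPQ : P * Q = 1 := by
    rw [hP, hQ, Matrix.mul_assoc, ← Matrix.mul_assoc W₁, hWW₁', Matrix.one_mul, hWW₀]
  set Λi : Matrix m m ℝ := Λ₀⁻¹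
  have hΛi : Λ₀ * Λi = 1 := Matrix.mul_nonsing_inv _ hΛ₀.det_pos.ne'.isUnit
  have hΛic : Λ₀.map (fun x : ℝ => (x : ℂ)) * Λi.map (fun x : ℝ => (x : ℂ)) = 1 :=
    map_ofReal_mul_eq_one hΛi
  -- On the circle Q Λ₀ Qᴴ = Λ₁ and P is the inverse of Q, so Q = Λ₁ Pᴴ Λ₀⁻¹. As Pᴴ at z is Pᵀ at
  -- 1/z, `R` is the reflection of `Q`.
  set R : Matrix m m TF := Λ₁.map RatFunc.C * Pᵀ * Λi.map RatFunc.C with hR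
  -- regularity outside the unit disc and at infinity
  have hQlim : EntrywiseMem TF.limits Q (B₁⁻¹ * B₀) := (hlim₁.inv_limits hB₁).mul hlim₀
  have hPlim : EntrywiseMem TF.limits P (B₀⁻¹ * B₁) := (hlim₀.inv_limits hB₀).mul hlim₁
  have hRlim : EntrywiseMem TF.limits R (Λ₁ * (B₀⁻¹ * B₁)ᵀ * Λi) :=
    ((EntrywiseMem.C_limits Λ₁).mul hPlim.transpose).mul (EntrywiseMem.C_limits Λi)
  have hval : ∀ {A : Matrix m m TF}, (∀ a b, TF.IsStable (A a b)) → ∀ {z : ℂ}, 1 ≤ ‖z‖ →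
      EntrywiseMem (TF.values z) A (A.map (RatFunc.eval (algebraMap ℝ ℂ) z)) := fun hA z hz =>
    EntrywiseMem.of_values fun a b h0 => (hA a b z h0).not_ge hz
  have hvali : ∀ {A : Matrix m m TF}, IsMinimumPhase A → ∀ {z : ℂ}, 1 < ‖z‖ →
      EntrywiseMem (TF.values z) A⁻¹ (A⁻¹.map (RatFunc.eval (algebraMap ℝ ℂ) z)) := fun hA z hz =>
    EntrywiseMem.of_values fun a b h0 => (hA.2 a b z h0).not_gt hz
  have hQp : ∀ a b, ∀ z : ℂ, aeval z (Q a b).denom = 0 → ‖z‖ ≤ 1 := by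
    intro a b z h0
    by_contra! hz
    exact (((hvali hmin₁ hz).mul (hval hst₀ hz.le)) a b).1 h0
  have hRp : ∀ a b, ∀ z : ℂ, aeval z (R a b).denom = 0 → ‖z‖ ≤ 1 := by
    intro a b z h0
    by_contra! hz
    exact ((((EntrywiseMem.C_values Λ₁ z).mul
      ((hvali hmin₀ hz).mul (hval hst₁ hz.le)).transpose).mul (EntrywiseMem.C_values Λi z)) a b).1 h0
  -- the frequencies at which the inverses may have poles
  let s : Set ℝ := ⋃ a, ⋃ b, ({ω | aeval (TF.circlePt ω) (W₀⁻¹ a b).denom = 0} ∪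
    {ω | aeval (TF.circlePt ω) (W₁⁻¹ a b).denom = 0})
  have hs : s.Countable := Set.countable_iUnion fun a => Set.countable_iUnion fun b =>
    (TF.countable_setOf_aeval_circlePt_eq_zero (RatFunc.denom_ne_zero _)).union
      (TF.countable_setOf_aeval_circlePt_eq_zero (RatFunc.denom_ne_zero _))
  have hcirc : ∀ ω ∉ s, ∃ Y : Matrix m m ℂ, EntrywiseMem (TF.values (TF.circlePt ω)) Q Y ∧
      EntrywiseMem (TF.values (TF.circlePt ω)⁻¹) R Y ∧
      Y * Λ₀.map (fun x : ℝ => (x : ℂ)) * Yᴴ = Λ₁.map (fun x : ℝ => (x : ℂ)) := by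
    intro ω hω
    simp only [s, Set.mem_iUnion, Set.mem_union, not_exists, not_or] at hω
    set z := TF.circlePt ω with hz
    have hz1 : 1 ≤ ‖z‖ := (TF.norm_circlePt ω).ge
    set Z₀ : Matrix m m ℂ := W₀.map (TF.freq · ω)
    set Z₁ : Matrix m m ℂ := W₁.map (TF.freq · ω)
    have h₀ : EntrywiseMem (TF.values z) W₀ Z₀ := hval hst₀ hz1
    have h₁ : EntrywiseMem (TF.values z) W₁ Z₁ := hval hst₁ hz1
    have hi₀ := EntrywiseMem.of_values (A := W₀⁻¹) (z := z) fun a b => (hω a b).1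
    have hi₁ := EntrywiseMem.of_values (A := W₁⁻¹) (z := z) fun a b => (hω a b).2
    set V₀ := W₀⁻¹.map (RatFunc.eval (algebraMap ℝ ℂ) z)
    set V₁ := W₁⁻¹.map (RatFunc.eval (algebraMap ℝ ℂ) z)
    have hV₁ : V₁ * Z₁ = 1 := by
      have := hi₁.mul h₁
      rw [hWW₁] at this
      exact this.values_unique EntrywiseMem.one
    have hPQz : (V₀ * Z₁) * (V₁ * Z₀) = 1 := by
      have := (hi₀.mul h₁).mul (hi₁.mul h₀)
      rw [← hP, ← hQ, hPQ] at this
      exact this.values_unique EntrywiseMem.one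
    have hY : (V₁ * Z₀) * Λ₀.map (fun x : ℝ => (x : ℂ)) * (V₁ * Z₀)ᴴ =
        Λ₁.map (fun x : ℝ => (x : ℂ)) := by
      calc (V₁ * Z₀) * Λ₀.map (fun x : ℝ => (x : ℂ)) * (V₁ * Z₀)ᴴ
          = V₁ * (Z₀ * Λ₀.map (fun x : ℝ => (x : ℂ)) * Z₀ᴴ) * V₁ᴴ := by
            simp only [Matrix.conjTranspose_mul, Matrix.mul_assoc]
        _ = (V₁ * Z₁) * Λ₁.map (fun x : ℝ => (x : ℂ)) * (V₁ * Z₁)ᴴ := by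
            rw [hspec ω]
            simp only [Matrix.conjTranspose_mul, Matrix.mul_assoc, Z₁]
        _ = _ := by rw [hV₁]; simp
    refine ⟨V₁ * Z₀, hi₁.mul h₀, ?_, hY⟩
    have hPc : EntrywiseMem (TF.values z⁻¹) Pᵀ (V₀ * Z₁)ᴴ := by
      intro a b
      rw [← TF.conj_circlePt]
      exact TF.conj_mem_values ((hi₀.mul h₁) b a)
    have hRz := ((EntrywiseMem.C_values Λ₁ z⁻¹).mul hPc).mul (EntrywiseMem.C_values Λi z⁻¹)
    have hYR : V₁ * Z₀ = Λ₁.map (fun x : ℝ => (x : ℂ)) * (V₀ * Z₁)ᴴ *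
        Λi.map (fun x : ℝ => (x : ℂ)) := by
      rw [← hY, Matrix.mul_assoc _ ((V₁ * Z₀)ᴴ), ← Matrix.conjTranspose_mul, hPQz,
        Matrix.conjTranspose_one, Matrix.mul_one, Matrix.mul_assoc, hΛic, Matrix.mul_one]
    rw [hYR]
    exact hRz
  obtain ⟨K, hK⟩ := exists_bound_of_mul_mul_conjTranspose_eq hΛ₀ (Λ₁.map (fun x : ℝ => (x : ℂ)))
  have hQC : Q = (B₁⁻¹ * B₀).map RatFunc.C := by
    ext a b
    refine TF.eq_C_of_reflection (hQlim a b) (hRlim a b) (hQp a b) (hRp a b) hs K fun ω hω => ?_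
    obtain ⟨Y, h1, h2, h3⟩ := hcirc ω hω
    exact ⟨Y a b, h1 a b, h2 a b, hK Y h3 a b⟩
  refine ⟨by rw [← hQC, hQ, ← Matrix.mul_assoc, hWW₁', Matrix.one_mul], ?_⟩
  obtain ⟨ω, hω⟩ : ∃ ω, ω ∉ s := by
    by_contra! h
    exact Cardinal.not_countable_real (hs.mono fun ω _ => h ω)
  obtain ⟨Y, h1, -, h3⟩ := hcirc ω hω
  rw [hQC] at h1
  have hYq := h1.values_unique (EntrywiseMem.C_values _ _)
  clear hQC h1 hQlim
  generalize B₁⁻¹ * B₀ = q at hYq ⊢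
  ext a b
  have h4 := congrFun₂ h3 a b
  rw [hYq] at h4
  simp only [Matrix.mul_apply, Matrix.map_apply, Matrix.conjTranspose_apply] at h4
  apply Complex.ofReal_injective
  rw [← h4]
  simp [Matrix.mul_apply]

end SpectralFactor

/-! ### Unit triangular matrices and congruence of diagonal matrices. -/

section UnitTriangular

variable {m α R : Type*} [Fintype m] [LinearOrder α] [CommRing R]
  {A B : Matrix m m R} {b : m → α}

/-- Block triangular with respect to an injective map, with a unit diagonal. -/
def IsUnitTriangular (A : Matrix m m R) (b : m → α) : Prop :=
  A.BlockTriangular b ∧ ∀ i, A i i = 1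

theorem mul_apply_self_of_blockTriangular (hb : b.Injective) (hA : A.BlockTriangular b)
    (hB : B.BlockTriangular b) (i : m) : (A * B) i i = A i i * B i i := by
  rw [Matrix.mul_apply]
  refine Finset.sum_eq_single i (fun k _ hk => ?_) (by simp)
  rcases lt_or_gt_of_ne (hb.ne hk) with h | h
  · rw [hA h, zero_mul]
  · rw [hB h, mul_zero]

theorem IsUnitTriangular.mul (hb : b.Injective) (hA : IsUnitTriangular A b)
    (hB : IsUnitTriangular B b) : IsUnitTriangular (A * B) b :=
  ⟨hA.1.mul hB.1, fun i => by
    rw [mul_apply_self_of_blockTriangular hb hA.1 hB.1, hA.2, hB.2, mul_one]⟩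

variable [DecidableEq m]

/-- In a kernel vector take the nonzero coordinate with the largest value of `b`: its row reduces to
that coordinate alone. -/
theorem IsUnitTriangular.det_ne_zero [IsDomain R] (hb : b.Injective)
    (hA : IsUnitTriangular A b) : A.det ≠ 0 := by
  intro h0
  obtain ⟨v, hv, hAv⟩ := Matrix.exists_mulVec_eq_zero_iff.2 h0
  obtain ⟨i₀, hi₀⟩ := Function.ne_iff.1 hv
  classical
  obtain ⟨i, hi, hmax⟩ := (Finset.univ.filter fun i => v i ≠ 0).exists_max_image b
    ⟨i₀, by simpa using hi₀⟩
  have h : ∑ k, A i k * v k = 0 := congrFun hAv i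
  rw [Finset.sum_eq_single i (fun k _ hk => ?_) (by simp), hA.2, one_mul] at h
  · exact (Finset.mem_filter.1 hi).2 h
  · by_cases hvk : v k = 0
    · rw [hvk, mul_zero]
    · have h1 := hmax k (by simpa using hvk)
      rw [hA.1 (lt_of_le_of_ne h1 (hb.ne hk)), zero_mul]

theorem IsUnitTriangular.inv [IsDomain R] {A : Matrix m m R} (hb : b.Injective)
    (hA : IsUnitTriangular A b) (hdet : IsUnit A.det) : IsUnitTriangular A⁻¹ b := by
  let _ : Invertible A := Matrix.invertibleOfIsUnitDet A hdet
  have h := Matrix.blockTriangular_inv_of_blockTriangular hA.1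
  refine ⟨h, fun i => ?_⟩
  have h1 := mul_apply_self_of_blockTriangular hb h hA.1 i
  rw [Matrix.nonsing_inv_mul _ hdet, hA.2, mul_one, Matrix.one_apply_eq] at h1
  exact h1.symm

/-- A unit triangular congruence between diagonal matrices without zeros on the diagonal is
trivial. -/
theorem IsUnitTriangular.eq_one_of_mul_mul_transpose {F : Type*} [Field F] {Q D E : Matrix m m F}
    (hb : b.Injective) (hQ : IsUnitTriangular Q b) (hD : D.IsDiag) (hE : E.IsDiag)
    (hDne : ∀ i, D i i ≠ 0) (h : Q * D * Qᵀ = E) : Q = 1 := by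
  have hdet := (hQ.det_ne_zero hb).isUnit
  have hQi := hQ.inv hb hdet
  -- The two sides are triangular in opposite directions, so the off-diagonal entries of `Q` vanish.
  have h1 : Q * D = E * (Q⁻¹)ᵀ := by
    rw [← h, Matrix.mul_assoc, ← Matrix.transpose_mul, Matrix.nonsing_inv_mul _ hdet,
      Matrix.transpose_one, Matrix.mul_one]
  ext i j
  by_cases hij : i = j
  · subst hij; rw [hQ.2, Matrix.one_apply_eq]
  rw [Matrix.one_apply_ne hij]
  rcases lt_or_gt_of_ne (hb.ne hij) with hlt | hlt
  · have h2 := congrFun₂ h1 i j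
    rw [Matrix.mul_apply, Matrix.mul_apply,
      Finset.sum_eq_single j (fun k _ hk => by rw [hD hk, mul_zero]) (by simp),
      Finset.sum_eq_single i (fun k _ hk => by rw [hE hk.symm, zero_mul]) (by simp),
      Matrix.transpose_apply, hQi.1 hlt, mul_zero] at h2
    exact (mul_eq_zero.1 h2).resolve_right (hDne j)
  · exact hQ.1 hlt

end UnitTriangular

theorem TF.atInfinity_zero : TF.atInfinity 0 = 0 := by simp [TF.atInfinity]

theorem TF.IsStrictlyProper.atInfinity_eq_zero {f : TF} (h : f.IsStrictlyProper) :
    f.atInfinity = 0 := by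
  refine Polynomial.coeff_eq_zero_of_degree_lt ?_
  rwa [← Polynomial.degree_eq_natDegree f.denom_ne_zero]

/-! ### The noise response is determined by the spectrum. -/

namespace ModelSet

variable {L K n : ℕ} {M : ModelSet L K n} {θ : Fin n → ℝ}

theorem IsAdmissible.isUnitTriangular_one_sub_Ginf (hadm : M.IsAdmissible) (hθ : θ ∈ M.Θ)
    {σ : Equiv.Perm (Fin L)} (hσ : ∀ j i, σ j < σ i → M.Ginf θ j i = 0) :
    IsUnitTriangular (1 - M.Ginf θ) (fun k => OrderDual.toDual (σ k)) := by
  refine ⟨fun i j hij => ?_, fun i => ?_⟩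
  · have hne : i ≠ j := by rintro rfl; exact lt_irrefl _ hij
    rw [Matrix.sub_apply, Matrix.one_apply_ne hne, hσ i j hij, sub_zero]
  · rw [Matrix.sub_apply, Matrix.one_apply_eq, Ginf, Matrix.map_apply, hadm.hollow_G θ hθ i,
      TF.atInfinity_zero, sub_zero]

variable (M) in
/-- The limit of `C T [H; 0]` for `z → ∞`. -/
def CTHinf (θ : Fin n → ℝ) : Matrix M.C M.C ℝ :=
  (1 - M.Ginf θ)⁻¹.submatrix (fun a : M.C => (a : Fin L)) (fun a : M.C => (a : Fin L))

/-- The noise model is monic, so [H; 0] tends to [I; 0], which selects the measured columns of the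
limit of `T`. -/
theorem IsAdmissible.limits_CTH (hadm : M.IsAdmissible) (hθ : θ ∈ M.Θ) :
    EntrywiseMem TF.limits (M.CTH θ) (M.CTHinf θ) := by
  have hT : EntrywiseMem TF.limits (M.T θ) (1 - M.Ginf θ)⁻¹ :=
    (hadm.limits_one_sub_G hθ).inv_limits (hadm.det_one_sub_Ginf_ne_zero hθ)
  have hH : EntrywiseMem TF.limits (M.H θ)
      (Matrix.of fun (a : Fin L) (c : M.C) => if a = c then (1 : ℝ) else 0) := by
    intro a c
    by_cases ha : a ∈ M.C
    · have h1 : M.H θ a c = M.Hmeas θ ⟨a, ha⟩ c := by simp [H, ha]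
      have h2 := congrFun₂ (hadm.monic_H θ hθ) ⟨a, ha⟩ c
      have h3 := (hadm.proper_H θ hθ ⟨a, ha⟩ c).mem_limits
      rw [Matrix.map_apply] at h2
      rw [h2] at h3
      rw [h1]
      convert h3 using 2
      simp [Matrix.one_apply, Subtype.ext_iff]
    · have h1 : M.H θ a c = 0 := by simp [H, ha]
      have h2 : a ≠ c := by rintro rfl; exact ha c.2
      rw [h1, Matrix.of_apply, if_neg h2]
      exact TF.limits.zero_mem
  convert! (hT.mul hH).submatrix (fun a : M.C => (a : Fin L)) id using 1
  ext a c
  simp [CTHinf, Matrix.mul_apply]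

theorem IsAdmissible.isStable_CTH (hadm : M.IsAdmissible) (hθ : θ ∈ M.Θ) (a b : M.C) :
    TF.IsStable (M.CTH θ a b) := by
  intro z hz
  by_contra! h1
  have hT : EntrywiseMem (TF.values z) (M.T θ) _ :=
    EntrywiseMem.of_values fun a b h0 => (hadm.stable_T θ hθ a b z h0).not_ge h1
  have hH : EntrywiseMem (TF.values z) (M.H θ) _ :=
    EntrywiseMem.of_values fun a b => by
      by_cases ha : a ∈ M.C
      · have h2 : M.H θ a b = M.Hmeas θ ⟨a, ha⟩ b := by simp [H, ha]
        rw [h2]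
        exact fun h0 => (hadm.stable_H θ hθ _ b z h0).not_ge h1
      · have h2 : M.H θ a b = 0 := by simp [H, ha]
        rw [h2]
        simp
  exact ((hT.mul hH) a b).1 hz

theorem IsAdmissible.CΦC_eq (hadm : M.IsAdmissible) (hθ : θ ∈ M.Θ) (ω : ℝ) :
    M.CΦC θ ω = (M.CTH θ).map (TF.freq · ω) * (M.Λ θ).map (fun x : ℝ => (x : ℂ)) *
      ((M.CTH θ).map (TF.freq · ω))ᴴ := by
  have h1 : 1 ≤ ‖TF.circlePt ω‖ := (TF.norm_circlePt ω).ge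
  have hT : EntrywiseMem (TF.values (TF.circlePt ω)) (M.T θ) ((M.T θ).map (TF.freq · ω)) :=
    EntrywiseMem.of_values fun a b h0 => (hadm.stable_T θ hθ a b _ h0).not_ge h1
  have hH : EntrywiseMem (TF.values (TF.circlePt ω)) (M.H θ) ((M.H θ).map (TF.freq · ω)) :=
    EntrywiseMem.of_values fun a b => by
      by_cases ha : a ∈ M.C
      · have h2 : M.H θ a b = M.Hmeas θ ⟨a, ha⟩ b := by simp [H, ha]
        rw [h2]
        exact fun h0 => (hadm.stable_H θ hθ _ b _ h0).not_ge h1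
      · have h2 : M.H θ a b = 0 := by simp [H, ha]
        rw [h2]
        simp
  have hW : (M.CTH θ).map (TF.freq · ω) =
      ((M.T θ).map (TF.freq · ω) * (M.H θ).map (TF.freq · ω)).submatrix
        (fun a : M.C => (a : Fin L)) id := by
    ext a b
    exact ((hT.mul hH) a b).2
  have hsub : ∀ (A : Matrix (Fin L) M.C ℂ) (B : Matrix M.C M.C ℂ),
      A.submatrix (fun a : M.C => (a : Fin L)) id * B *
        (A.submatrix (fun a : M.C => (a : Fin L)) id)ᴴ =
      (A * B * Aᴴ).submatrix (fun a : M.C => (a : Fin L)) (fun a : M.C => (a : Fin L)) :=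
    fun _ _ => rfl
  rw [hW, hsub, Matrix.conjTranspose_mul, ← Matrix.mul_assoc]
  rfl

/-- The measured spectrum factors through Λ, so full rank at a single frequency makes the
semidefinite Λ nonsingular. -/
theorem FullRankSpectrum.posDef_Λ (hfull : M.FullRankSpectrum) (hadm : M.IsAdmissible)
    (hθ : θ ∈ M.Θ) : (M.Λ θ).PosDef := by
  rw [(hadm.posSemidef_Λ θ hθ).posDef_iff_det_ne_zero]
  intro h0
  obtain ⟨ω, hω⟩ := (hfull θ hθ).exists
  have hle : M.C.card ≤ ((M.Λ θ).map (fun x : ℝ => (x : ℂ))).rank := by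
    rw [← hω, hadm.CΦC_eq hθ]
    exact (Matrix.rank_mul_le_left _ _).trans (Matrix.rank_mul_le_right _ _)
  have hdet : ((M.Λ θ).map (fun x : ℝ => (x : ℂ))).det = 0 := by
    have := RingHom.map_det Complex.ofRealHom (M.Λ θ)
    rw [h0, map_zero] at this
    exact this.symm
  have hli : ¬ LinearIndependent ℂ ((M.Λ θ).map (fun x : ℝ => (x : ℂ))).row := by
    rw [Matrix.linearIndependent_rows_iff_isUnit, Matrix.isUnit_iff_isUnit_det, hdet]
    simp
  rw [linearIndependent_iff_card_eq_finrank_span, Set.finrank, ← Matrix.rank_eq_finrank_span_row,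
    Fintype.card_coe] at hli
  refine hli (le_antisymm hle ?_)
  simpa using Matrix.rank_le_card_height ((M.Λ θ).map (fun x : ℝ => (x : ℂ)))

/-- The measured spectrum determines the noise transfer matrix `C T [H; 0]`. -/
theorem IsAdmissible.CTH_eq_of_CΦC_eq (hadm : M.IsAdmissible) (hfull : M.FullRankSpectrum)
    (hfeed : M.FeedthroughCondition) (hmin : M.MinimumPhaseResponse) {θ₀ θ₁ : Fin n → ℝ}
    (h₀ : θ₀ ∈ M.Θ) (h₁ : θ₁ ∈ M.Θ) (h : ∀ ω : ℝ, M.CΦC θ₀ ω = M.CΦC θ₁ ω) :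
    M.CTH θ₀ = M.CTH θ₁ := by
  obtain ⟨σ, hσ⟩ : ∃ σ : Equiv.Perm (Fin L), ∀ θ ∈ M.Θ, ∀ j i, σ j < σ i → M.Ginf θ j i = 0 := by
    rcases hfeed with hf | ⟨-, hf⟩
    · exact ⟨1, fun θ hθ j i _ => (hf θ hθ j i).atInfinity_eq_zero⟩
    · exact hf
  -- `BlockTriangular` means upper triangular; the limit of `G` is lower triangular, hence the dual
  -- order.
  let b : M.C → (Fin L)ᵒᵈ := fun k => OrderDual.toDual (σ k)
  have hb : b.Injective := fun k l hkl => Subtype.ext (σ.injective hkl)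
  have htri : ∀ θ ∈ M.Θ, IsUnitTriangular (M.CTHinf θ) b := by
    intro θ hθ
    have hinj : Function.Injective fun k : Fin L => OrderDual.toDual (σ k) :=
      fun k l hkl => σ.injective hkl
    have hT := (hadm.isUnitTriangular_one_sub_Ginf hθ (hσ θ hθ)).inv hinj
      (hadm.det_one_sub_Ginf_ne_zero hθ).isUnit
    exact ⟨hT.1.submatrix, fun k => hT.2 k⟩
  have hspec : ∀ ω : ℝ, _ := fun ω => (hadm.CΦC_eq h₀ ω).symm.trans ((h ω).trans (hadm.CΦC_eq h₁ ω))
  obtain ⟨hW, hΛ⟩ := spectralFactor_unique (hadm.isStable_CTH h₀) (hadm.isStable_CTH h₁)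
    (hmin θ₀ h₀) (hmin θ₁ h₁) (hadm.limits_CTH h₀) (hadm.limits_CTH h₁)
    ((htri θ₀ h₀).det_ne_zero hb) ((htri θ₁ h₁).det_ne_zero hb) (hfull.posDef_Λ hadm h₀) hspec
  -- For strictly proper `G` both limits are the identity. Otherwise the quotient is a unit
  -- triangular congruence between diagonal positive definite covariances.
  have hq : (M.CTHinf θ₁)⁻¹ * M.CTHinf θ₀ = 1 := by
    rcases hfeed with hf | ⟨hdiag, -⟩
    · have hone : ∀ θ ∈ M.Θ, M.CTHinf θ = 1 := by
        intro θ hθ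
        have hG : M.Ginf θ = 0 := by
          ext j i
          exact (hf θ hθ j i).atInfinity_eq_zero
        rw [CTHinf, hG, sub_zero, inv_one]
        exact Matrix.submatrix_one _ Subtype.val_injective
      rw [hone θ₀ h₀, hone θ₁ h₁, inv_one, Matrix.one_mul]
    · have hu := ((htri θ₁ h₁).inv hb ((htri θ₁ h₁).det_ne_zero hb).isUnit).mul hb (htri θ₀ h₀)
      exact hu.eq_one_of_mul_mul_transpose hb (hdiag θ₀ h₀) (hdiag θ₁ h₁)
        (fun k => ((hfull.posDef_Λ hadm h₀).diag_pos).ne') hΛ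
  rw [hW, hq, Matrix.map_one _ (map_zero _) (map_one _), Matrix.mul_one]

/-! ### Network equations and the identifiability argument. -/

/-- The measured responses of two models with the same `C T R` and `C T [H; 0]` coincide. -/
theorem resp_eq_of_CTR_eq_of_CTH_eq {θ₀ θ₁ : Fin n → ℝ} (hR : M.CTR θ₀ = M.CTR θ₁)
    (hH : M.CTH θ₀ = M.CTH θ₁) {k : Fin L} (hk : k ∈ M.C) (y : M.Ext) :
    M.resp θ₀ (Sum.inl k) y = M.resp θ₁ (Sum.inl k) y := by
  have h : ∀ θ, M.resp θ (Sum.inl k) y = Matrix.fromCols (M.CTR θ) (M.CTH θ) ⟨k, hk⟩ y := by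
    intro θ
    rw [resp, Matrix.fromRows_apply_inl, X, Matrix.mul_fromCols]
    rcases y with y | y <;> rfl
  rw [h, h, hR, hH]

/-- An internal signal that is not measured is driven by at most one external signal. -/
theorem X_apply_of_notMem {i : Fin L} (hi : i ∉ M.C) {x : M.Ext}
    (hx : M.Edge (Sum.inr x) (Sum.inl i)) (θ : Fin n → ℝ) (y : M.Ext) :
    M.X θ i y = if y = x then 1 else 0 := by
  obtain ⟨θ', -, h⟩ := hx
  change M.X θ' i x ≠ 0 at h
  rcases x with r | c
  · have hr : i = M.rIn r := by
      by_contra hne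
      exact h (by simp [X, R, hne])
    rcases y with r' | c'
    · by_cases hrr : r' = r
      · subst hrr
        simp [X, R, hr]
      · have : i ≠ M.rIn r' := fun h' => hrr (M.rIn.injective (h'.symm.trans hr))
        simp [X, R, this, hrr]
    · simp [X, H, hi]
  · exact absurd (by simp [X, H, hi]) h

theorem IsAdmissible.resp_inl (hadm : M.IsAdmissible) {θ : Fin n → ℝ} (hθ : θ ∈ M.Θ) (k : Fin L)
    (y : M.Ext) : M.resp θ (Sum.inl k) y =
      ∑ l, M.G θ k l * M.resp θ (Sum.inl l) y + M.X θ k y := by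
  have h : M.T θ * M.X θ = M.G θ * (M.T θ * M.X θ) + M.X θ := by
    have h1 : M.X θ = (1 - M.G θ) * (M.T θ * M.X θ) := by
      rw [← Matrix.mul_assoc, hadm.one_sub_G_mul_T hθ, Matrix.one_mul]
    nth_rewrite 3 [h1]
    rw [Matrix.sub_mul, Matrix.one_mul, add_sub_cancel]
  exact congrFun₂ h k y

theorem G_eq_zero_of_not_edge {θ : Fin n → ℝ} (hθ : θ ∈ M.Θ) {k l : Fin L}
    (h : ¬ M.Edge (Sum.inl l) (Sum.inl k)) : M.G θ k l = 0 := by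
  by_contra h0
  exact h ⟨θ, hθ, h0⟩

/-- The identifiability criterion for the module from an unmeasured to a measured signal. -/
theorem IsAdmissible.genericallyIdentifiable_of_isDisconnecting
    (hadm : M.IsAdmissible)
    (hfull : M.FullRankSpectrum)
    (hind : M.IndependentlyParameterized)
    (hfeed : M.FeedthroughCondition)
    (hmin : M.MinimumPhaseResponse)
    (hfix : M.FixedEntriesRegular)
    (i j : Fin L) (hj : j ∈ M.C) (hi : i ∉ M.C)
    (x : M.Ext)
    (hx_edge : M.Edge (Sum.inr x) (Sum.inl i))
    (hD : ∃ Xbar Cbar : Set M.Vert, ∃ D : Finset M.Vert,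
      Xbar ⊆ M.extNoUnknown j \ {Sum.inr x} ∧
      Cbar ⊆ M.measVerts ∧
      IsDisconnecting M.Edge (Xbar ∪ {Sum.inr x})
        (M.inNbrs i ∪ (M.inNbrsMinus j \ {Sum.inl i}) ∪ Cbar) (D : Set M.Vert) ∧
      maxDisjointPaths M.Edge (Xbar ∪ {Sum.inr x}) ((D : Set M.Vert) ∪ {Sum.inl i})
        = 1 + D.card ∧
      maxDisjointPaths M.Edge (D : Set M.Vert) Cbar = D.card) :
    M.GenericallyIdentifiable j i := by
  classical
  obtain ⟨Xbar, Cbar, D, hX, hC, hdisc, hp1, hp2⟩ := hD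
  set A : Set M.Vert := Xbar ∪ {Sum.inr x} with hA
  have hAext : ∀ k, (Sum.inl k : M.Vert) ∉ A := by
    rintro k (hk | hk)
    · obtain ⟨⟨y, hy, -⟩, -⟩ := hX hk
      cases hy
    · cases hk
  have hcoe : ((D : Set M.Vert) ∪ {Sum.inl i}) = ((insert (Sum.inl i) D : Finset M.Vert) :
      Set M.Vert) := by
    ext v; simp [or_comm]
  -- `w_i` is not in `D`, as the set `D ∪ {w_i}` has `1 + |D|` elements
  have hiD : (Sum.inl i : M.Vert) ∉ D := by
    intro h
    obtain ⟨S⟩ := exists_pathSystem M.Edge A ((D : Set M.Vert) ∪ {Sum.inl i})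
    have h1 := Set.ncard_le_ncard S.tails_subset (Set.toFinite _)
    rw [S.ncard_tails, hp1, hcoe, Set.ncard_coe_finset, Finset.insert_eq_of_mem h] at h1
    omega
  have hdisc' : IsDisconnecting M.Edge A Cbar (D : Set M.Vert) := by
    rintro p ⟨h1, h2, h3, b, hb, h4⟩
    exact hdisc p ⟨h1, h2, h3, b, Or.inr hb, h4⟩
  rw [hcoe] at hp1
  have hae1 := hadm.ae_linearIndependent_resp hind hfix hAext (B := insert (Sum.inl i) D)
    (by rw [hp1, Finset.card_insert_of_notMem hiD, add_comm])
  have hae2 := hadm.ae_eq_zero_of_eq_zero_on_target hind hfix hdisc' hp2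
  filter_upwards [hae1, hae2] with θ₀ hg1 hg2 h₀ θ₁ h₁ hCTR hspec
  have hCTH := hadm.CTH_eq_of_CΦC_eq hfull hfeed hmin h₀ h₁ hspec
  -- the responses of the vertices to the external signals in `A`
  let t : (Fin n → ℝ) → M.Vert → ({y : M.Ext // Sum.inr y ∈ A} → TF) := fun θ v y => M.resp θ v y
  let S : (Fin n → ℝ) → Submodule TF ({y : M.Ext // Sum.inr y ∈ A} → TF) := fun θ =>
    Submodule.span TF (t θ '' D)
  have htC : ∀ k ∈ M.C, t θ₀ (Sum.inl k) = t θ₁ (Sum.inl k) := fun k hk => by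
    ext y
    exact resp_eq_of_CTR_eq_of_CTH_eq hCTR hCTH hk y
  -- functionals of the responses
  have hφ1 : ∀ θ ∈ M.Θ, ∀ φ : Module.Dual TF ({y : M.Ext // Sum.inr y ∈ A} → TF),
      M.GIX θ *ᵥ (fun v => φ (t θ v)) = 0 := by
    intro θ hθ φ
    ext k
    have h1 : ∑ v, M.GIX θ k v • t θ v = 0 := by
      ext y
      simpa [Matrix.mul_apply, t] using congrFun₂ (hadm.GIX_mul_resp hθ) k y.1
    have h2 := congrArg φ h1
    rw [map_sum, map_zero] at h2
    simpa [Matrix.mulVec, dotProduct] using h2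
  have hφ2 : ∀ θ, ∀ φ : Module.Dual TF ({y : M.Ext // Sum.inr y ∈ A} → TF),
      ∀ y : M.Ext, Sum.inr y ∉ A → φ (t θ (Sum.inr y)) = 0 := by
    intro θ φ y hy
    have : t θ (Sum.inr y) = 0 := by
      ext y'
      have hne : y ≠ y' := by rintro rfl; exact hy y'.2
      simp [t, resp, Matrix.one_apply_ne hne]
    rw [this, map_zero]
  -- Membership in a span is tested by functionals that vanish on it; applied to all responses, such
  -- a functional solves the network equations and vanishes on `D`.
  have hsep : ∀ θ ∈ M.Θ, ∀ k, (Sum.inl k : M.Vert) ∈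
      M.inNbrs i ∪ (M.inNbrsMinus j \ {Sum.inl i}) ∪ Cbar → t θ (Sum.inl k) ∈ S θ := by
    intro θ hθ k hk
    by_contra hnot
    obtain ⟨φ, hφ, hφS⟩ := Submodule.exists_le_ker_of_notMem hnot
    refine hφ (hadm.eq_zero_of_not_reachable (A := A) (D := (D : Set M.Vert)) hθ (hφ1 θ hθ φ)
      (hφ2 θ φ) (fun v hv => ?_) k (hdisc.notMem_reachableAvoiding hk))
    exact hφS (Submodule.subset_span ⟨v, hv, rfl⟩)
  have hS₀C : S θ₀ ≤ Submodule.span TF (t θ₀ '' Cbar) := by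
    refine Submodule.span_le.2 ?_
    rintro _ ⟨v, hv, rfl⟩
    by_contra hnot
    obtain ⟨φ, hφ, hφS⟩ := Submodule.exists_le_ker_of_notMem hnot
    exact hφ (hg2 h₀ _ (hφ1 θ₀ h₀ φ) (hφ2 θ₀ φ)
      (fun c hc => hφS (Submodule.subset_span ⟨c, hc, rfl⟩)) v hv)
  have hCS₁ : Submodule.span TF (t θ₀ '' Cbar) ≤ S θ₁ := by
    refine Submodule.span_le.2 ?_
    rintro _ ⟨v, hv, rfl⟩
    obtain ⟨k, hk, rfl⟩ := hC hv
    rw [htC k hk]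
    exact hsep θ₁ h₁ k (Or.inr hv)
  have hlin : ∀ c : M.Vert → TF, (∀ v ∉ insert (Sum.inl i) D, c v = 0) →
      ∑ v, c v • t θ₀ v = 0 → c = 0 := by
    intro c hc hsum
    refine hg1 h₀ c hc fun y hy => ?_
    have := congrFun hsum ⟨y, hy⟩
    simpa [Matrix.vecMul, dotProduct, t] using this
  have hli : LinearIndependent TF (fun v : (insert (Sum.inl i) D : Finset M.Vert) => t θ₀ v) := by
    rw [Fintype.linearIndependent_iff]
    intro g hg v
    let c : M.Vert → TF := fun v => if h : v ∈ insert (Sum.inl i) D then g ⟨v, h⟩ else 0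
    have hc0 : c = 0 := by
      refine hlin c (fun v hv => dif_neg hv) ?_
      rw [← hg, ← Finset.sum_subset (Finset.subset_univ (insert (Sum.inl i) D))
        (fun v _ hv => by rw [show c v = 0 from dif_neg hv, zero_smul]), ← Finset.sum_coe_sort]
      exact Finset.sum_congr rfl fun v _ => by rw [show c v = g v from dif_pos v.2]
    have := congrFun hc0 v
    rwa [show c v = g v from dif_pos v.2] at this
  have hrank₀ : Module.finrank TF (S θ₀) = D.card := by
    have h1 : LinearIndependent TF (fun v : D => t θ₀ v) :=
      hli.comp (fun v : D => ⟨v, Finset.mem_insert_of_mem v.2⟩)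
        fun a b h => Subtype.ext (by simpa using h)
    have h2 := finrank_span_eq_card h1
    have h3 : Set.range (fun v : D => t θ₀ v) = t θ₀ '' D := by
      ext; simp
    rwa [h3, Fintype.card_coe] at h2
  have hrank₁ : Module.finrank TF (S θ₁) ≤ D.card := by
    have := finrank_span_finset_le_card (R := TF) (D.image (t θ₁))
    rw [Finset.coe_image] at this
    exact this.trans Finset.card_image_le
  -- Genericity enters through θ₀ alone: for θ₁ the inclusion and the trivial bound |D| on the
  -- dimension suffice.
  have hSS : S θ₀ = S θ₁ :=
    Submodule.eq_of_le_of_finrank_le (hS₀C.trans hCS₁) (by rw [hrank₀]; exact hrank₁)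
  have hti : t θ₀ (Sum.inl i) ∉ S θ₀ := by
    have h1 := hli.notMem_span_image (s := {v | v.1 ∈ D})
      (x := ⟨Sum.inl i, Finset.mem_insert_self _ _⟩) hiD
    have h2 : (fun v : (insert (Sum.inl i) D : Finset M.Vert) => t θ₀ v) '' {v | v.1 ∈ D} =
        t θ₀ '' D := by
      ext w
      constructor
      · rintro ⟨v, hv, rfl⟩
        exact ⟨v, hv, rfl⟩
      · rintro ⟨v, hv, rfl⟩
        exact ⟨⟨v, Finset.mem_insert_of_mem hv⟩, hv, rfl⟩
    rwa [h2] at h1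
  -- the row of `w_i`
  let e : {y : M.Ext // Sum.inr y ∈ A} → TF := fun y => if y.1 = x then 1 else 0
  have hrow : ∀ θ ∈ M.Θ, t θ (Sum.inl i) - e ∈ S θ := by
    intro θ hθ
    have : t θ (Sum.inl i) - e = ∑ l, M.G θ i l • t θ (Sum.inl l) := by
      ext y
      have h1 := hadm.resp_inl hθ i y
      rw [X_apply_of_notMem hi hx_edge] at h1
      simp [t, e, h1]
    rw [this]
    refine Submodule.sum_mem _ fun l _ => ?_
    by_cases hE : M.Edge (Sum.inl l) (Sum.inl i)
    · exact Submodule.smul_mem _ _ (hsep θ hθ l (Or.inl (Or.inl ⟨l, rfl, hE⟩)))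
    · rw [G_eq_zero_of_not_edge hθ hE, zero_smul]
      exact Submodule.zero_mem _
  have heS : e ∉ S θ₀ := by
    intro he
    refine hti ?_
    have := Submodule.add_mem _ (hrow θ₀ h₀) he
    rwa [sub_add_cancel] at this
  -- the row of `w_j`
  have hXj : ∀ y : M.Ext, Sum.inr y ∈ A → M.X θ₀ j y = M.X θ₁ j y := by
    rintro y (hy | hy)
    · obtain ⟨⟨y', hy', hno⟩, -⟩ := hX hy
      by_cases hE : M.Edge (Sum.inr y) (Sum.inl j)
      · have hK : M.Known (Sum.inr y) j := by
          by_contra hK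
          exact hno ⟨hE, hK⟩
        exact hK θ₀ h₀ θ₁ h₁
      · have h2 : ∀ θ ∈ M.Θ, M.X θ j y = 0 := by
          intro θ hθ
          by_contra h0
          exact hE ⟨θ, hθ, h0⟩
        rw [h2 θ₀ h₀, h2 θ₁ h₁]
    · obtain rfl : y = x := Sum.inr_injective hy
      rcases y with r | c
      · simp [ModelSet.X]
      · obtain ⟨θ', -, h⟩ := hx_edge
        exact absurd (by simp [edgeTF, ModelSet.X, ModelSet.H, hi]) h
  have hdiff : ∑ l, (M.G θ₀ j l • t θ₀ (Sum.inl l) - M.G θ₁ j l • t θ₁ (Sum.inl l)) = 0 := by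
    ext y
    have e0 := hadm.resp_inl h₀ j y
    have e1 := hadm.resp_inl h₁ j y
    have e2 := resp_eq_of_CTR_eq_of_CTH_eq hCTR hCTH hj y.1
    have e3 := hXj y y.2
    have : ∑ l, M.G θ₀ j l * M.resp θ₀ (Sum.inl l) y = ∑ l, M.G θ₁ j l * M.resp θ₁ (Sum.inl l) y := by
      linear_combination e2 - e0 + e1 - e3
    simp [t, Finset.sum_sub_distrib, this]
  have hother : ∀ l ∈ Finset.univ.erase i,
      M.G θ₀ j l • t θ₀ (Sum.inl l) - M.G θ₁ j l • t θ₁ (Sum.inl l) ∈ S θ₀ := by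
    intro l hl
    by_cases hE : M.Edge (Sum.inl l) (Sum.inl j)
    · by_cases hK : l ∈ M.C ∧ M.Known (Sum.inl l) j
      · have h1 : M.G θ₀ j l = M.G θ₁ j l := hK.2 θ₀ h₀ θ₁ h₁
        rw [h1, htC l hK.1, sub_self]
        exact Submodule.zero_mem _
      · have hmem : (Sum.inl l : M.Vert) ∈
            M.inNbrs i ∪ (M.inNbrsMinus j \ {Sum.inl i}) ∪ Cbar := by
          refine Or.inl (Or.inr ⟨⟨l, rfl, hE, hK⟩, fun h => ?_⟩)
          exact Finset.ne_of_mem_erase hl (Sum.inl_injective h)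
        refine Submodule.sub_mem _ (Submodule.smul_mem _ _ (hsep θ₀ h₀ l hmem))
          (Submodule.smul_mem _ _ ?_)
        rw [hSS]
        exact hsep θ₁ h₁ l hmem
    · rw [G_eq_zero_of_not_edge h₀ hE, G_eq_zero_of_not_edge h₁ hE]
      simp
  have hi_mem : M.G θ₀ j i • t θ₀ (Sum.inl i) - M.G θ₁ j i • t θ₁ (Sum.inl i) ∈ S θ₀ := by
    rw [← Finset.add_sum_erase _ _ (Finset.mem_univ i)] at hdiff
    rw [eq_neg_of_add_eq_zero_left hdiff]
    exact Submodule.neg_mem _ (Submodule.sum_mem _ hother)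
  -- Modulo the common space, the response of `w_i` may be replaced by `e` in both models.
  have hfin : (M.G θ₀ j i - M.G θ₁ j i) • e ∈ S θ₀ := by
    have h2 := hrow θ₁ h₁
    rw [← hSS] at h2
    have h3 := Submodule.add_mem _ (Submodule.sub_mem _ hi_mem
      (Submodule.smul_mem _ (M.G θ₀ j i) (hrow θ₀ h₀))) (Submodule.smul_mem _ (M.G θ₁ j i) h2)
    convert h3 using 1
    rw [smul_sub, smul_sub, sub_smul]
    abel
  by_contra hne
  exact heS ((Submodule.smul_mem_iff _ (sub_ne_zero.2 hne)).1 hfin)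

end ModelSet

end DynNet

end

theorem mainTheorem3 {L K n : ℕ} (M : DynNet.ModelSet L K n)
    (hadm : M.IsAdmissible)
    (hfull : M.FullRankSpectrum)
    (hind : M.IndependentlyParameterized)
    (hfeed : M.FeedthroughCondition)
    (hmin : M.MinimumPhaseResponse)
    (hfix : M.FixedEntriesRegular)
    (i j : Fin L) (hj : j ∈ M.C) (hi : i ∉ M.C)
    (x : M.Ext)
    (hx_deg : M.outDegree (Sum.inr x) = 1)
    (hx_edge : M.Edge (Sum.inr x) (Sum.inl i))
    (hx_known : M.Known (Sum.inr x) i)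
    (hD : ∃ Xbar Cbar : Set M.Vert, ∃ D : Finset M.Vert,
      Xbar ⊆ M.extNoUnknown j \ {Sum.inr x} ∧
      Cbar ⊆ M.measVerts ∧
      DynNet.IsDisconnecting M.Edge (Xbar ∪ {Sum.inr x})
        (M.inNbrs i ∪ (M.inNbrsMinus j \ {Sum.inl i}) ∪ Cbar) (D : Set M.Vert) ∧
      DynNet.maxDisjointPaths M.Edge (Xbar ∪ {Sum.inr x}) ((D : Set M.Vert) ∪ {Sum.inl i})
        = 1 + D.card ∧
      DynNet.maxDisjointPaths M.Edge (D : Set M.Vert) Cbar = D.card) :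
    M.GenericallyIdentifiable j i :=
  hadm.genericallyIdentifiable_of_isDisconnecting hfull hind hfeed hmin hfix i j hj hi x hx_edge hD
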